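/- Let $m,n\in\mathbb N$ with $n\ge m$, and let $P_m(\mathbb R)$ be the cone of real symmetric positive definite $m\times m$ matrices. For a symmetric matrix $A$ let $\nu(A)=(a_{ij})_{1\le i\le j\le m}\in\mathbb R^{m(m+1)/2}$ be the vector of its upper triangular entries, let $\mathrm{vec}(A)\in\mathbb R^{m^2}$ be the concatenation of its columns, and let $D_m$ be the unique $m^2\times\frac{m(m+1)}2$ matrix with $D_m\,\nu(A)=\mathrm{vec}(A)$ for every symmetric $A$. Put $\Gamma_m(z)=\pi^{m(m-1)/4}\prod_{j=1}^m\Gamma\big(z+\tfrac{1-j}2\big)$. Densities on $P_m(\mathbb R)$ are taken with respect to the Lebesgue measure $\prod_{i\le j}dx_{ij}$. For $\Sigma\in P_m(\mathbb R)$, the Wishart and the inverse Wishart distributions with $n$ degrees of freedom and parameter $\Sigma$ have the densities $$w_\Sigma(X)=\frac{(\det X)^{(n-m-1)/2}e^{-\frac12\mathrm{tr}(\Sigma^{-1}X)}}{2^{nm/2}(\det\Sigma)^{n/2}\,\Gamma_m(n/2)},\qquad p_\Sigma(X)=\frac{(\det\Sigma)^{n/2}(\det X)^{-(n+m+1)/2}e^{-\frac12\mathrm{tr}(\Sigma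 X^{-1})}}{2^{nm/2}\,\Gamma_m(n/2)},\qquad X\in P_m(\mathbb R).$$ Both families are parametrised by $\xi=\nu(\Sigma)$, $\Sigma\in P_m(\mathbb R)$. The Fisher matrix of a family $(p_\xi)$ is $G(\xi)=[g_{ij}(\xi)]$ with $g_{ij}(\xi)=\int p_\xi\,(\partial_i\log p_\xi)(\partial_j\log p_\xi)$, and the Fisher--Rao distance $d_{\mathrm{FR}}(\xi_1,\xi_2)$ is the infimum of $\int_0^1\sqrt{\dot\xi(t)^{\mathsf T}G(\xi(t))\,\dot\xi(t)}\,dt$ over the piecewise continuously differentiable curves $\xi$ on $[0,1]$ in the parameter space from $\xi_1$ to $\xi_2$; write $d_{\mathrm{FR}}(\Sigma_1,\Sigma_2)$ for $d_{\mathrm{FR}}(\nu(\Sigma_1),\nu(\Sigma_2))$. Then the following hold. 1. For every $\Sigma\in P_m(\mathbb R)$, $p_\Sigma$ is a probability density, and if $X$ has the inverse Wishart distribution with parameter $\Sigma$, then $Y=X^{-1}$ has the Wishart distribution with parameter $\Phi=\Sigma^{-1}$ (and the same $n$). 2. For every $\Sigma\in P_m(\mathbb R)$, the integrals defining the Fisher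 matrices at $\xi=\nu(\Sigma)$ of the inverse Wishart family and of the Wishart family converge absolutely, and both Fisher matrices are equal to $$G(\xi)=\frac n2\,D_m^{\mathsf T}\,(\Sigma^{-1}\otimes\Sigma^{-1})\,D_m .$$ 3. For all $\Sigma_1,\Sigma_2\in P_m(\mathbb R)$, the Fisher--Rao distance of the inverse Wishart family is $$d_{\mathrm{FR}}(\Sigma_1,\Sigma_2)=\sqrt{\frac n2}\,\Big\|\log\big(\Sigma_1^{-1/2}\Sigma_2\Sigma_1^{-1/2}\big)\Big\|_F=\sqrt{\frac n2\sum_{k=1}^m(\log\lambda_k)^2},$$ where $\log$ is the matrix logarithm, $\|A\|_F=\sqrt{\mathrm{tr}(AA^{\mathsf T})}$, and $\lambda_1,\dots,\lambda_m$ are the eigenvalues, with multiplicity, of the symmetric matrix $\Sigma_1^{-1/2}\Sigma_2\Sigma_1^{-1/2}$. -/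

import Mathlib

open MeasureTheory Matrix
open scoped Kronecker

noncomputable section

namespace FisherRao

/-! ### Parametric families, Fisher matrix, Fisher–Rao distance -/

section General

variable {ι 𝒳 : Type*} [Fintype ι] [DecidableEq ι] [MeasurableSpace 𝒳]

/-- The partial derivative `∂_i ℓ(ξ)` of the log-likelihood `ℓ(ξ) = log p_ξ`, at the sample
point `x`. -/
def score (p : (ι → ℝ) → 𝒳 → ℝ) (ξ : ι → ℝ) (i : ι) (x : 𝒳) : ℝ :=
  lineDeriv ℝ (fun η => Real.log (p η x)) ξ (Pi.single i 1)

/-- The function `p_ξ · ∂_i log p_ξ · ∂_j log p_ξ` on the sample space. -/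
def fisherIntegrand (p : (ι → ℝ) → 𝒳 → ℝ) (ξ : ι → ℝ) (i j : ι) (x : 𝒳) : ℝ :=
  p ξ x * score p ξ i x * score p ξ j x

/-- The Fisher matrix `g_ij(ξ) = ∫ p_ξ (∂_i log p_ξ) (∂_j log p_ξ) dμ` of the family `p` of
densities with respect to `μ`. -/
def fisherMatrix (μ : Measure 𝒳) (p : (ι → ℝ) → 𝒳 → ℝ) (ξ : ι → ℝ) : Matrix ι ι ℝ :=
  Matrix.of fun i j => ∫ x, fisherIntegrand p ξ i j x ∂μ

/-- `c` is continuous and piecewise continuously differentiable on `[0, 1]`. -/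
def IsPiecewiseC1 (c : ℝ → ι → ℝ) : Prop :=
  ContinuousOn c (Set.Icc 0 1) ∧
    ∃ (N : ℕ) (t : ℕ → ℝ), t 0 = 0 ∧ t N = 1 ∧
      ∀ k < N, t k < t (k + 1) ∧ ContDiffOn ℝ 1 c (Set.Icc (t k) (t (k + 1)))

/-- The length `∫₀¹ √(ċ(t)ᵀ G(c(t)) ċ(t)) dt` of a curve for the metric with matrix `G`. -/
def curveLength (G : (ι → ℝ) → Matrix ι ι ℝ) (c : ℝ → ι → ℝ) : ℝ :=
  ∫ t in (0 : ℝ)..1, √(deriv c t ⬝ᵥ (G (c t) *ᵥ deriv c t))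

/-- The Fisher–Rao distance between two parameters of the family `p` with parameter space `Ξ`:
the infimum of the lengths, for the Fisher metric, of the piecewise continuously differentiable
curves in `Ξ` that join them. -/
def fisherRaoDist (Ξ : Set (ι → ℝ)) (μ : Measure 𝒳) (p : (ι → ℝ) → 𝒳 → ℝ)
    (ξ₁ ξ₂ : ι → ℝ) : ℝ :=
  sInf {l | ∃ c : ℝ → ι → ℝ, IsPiecewiseC1 c ∧ (∀ t ∈ Set.Icc (0 : ℝ) 1, c t ∈ Ξ) ∧
    c 0 = ξ₁ ∧ c 1 = ξ₂ ∧ l = curveLength (fisherMatrix μ p) c}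

end General

/-! ### Coordinates on symmetric matrices -/

/-- The index pairs `(i, j)` with `i ≤ j`; there are `m (m + 1) / 2` of them. -/
abbrev UpperIdx (m : ℕ) : Type := {q : Fin m × Fin m // q.1 ≤ q.2}

/-- The position in the upper triangle of the entry `(i, j)` of a symmetric matrix. -/
def upperIdx {m : ℕ} (i j : Fin m) : UpperIdx m := ⟨(min i j, max i j), min_le_max⟩

/-- `ν(A)`, the vector of the entries `a_{ij}`, `i ≤ j`, of `A`. -/
def nu {m : ℕ} (A : Matrix (Fin m) (Fin m) ℝ) : UpperIdx m → ℝ := fun q => A q.1.1 q.1.2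

/-- The symmetric matrix with given upper triangular entries. -/
def symMat {m : ℕ} (ξ : UpperIdx m → ℝ) : Matrix (Fin m) (Fin m) ℝ :=
  Matrix.of fun i j => ξ (upperIdx i j)

/-- The cone of positive definite matrices in the coordinates `ν`, an open subset of
`ℝ^{m(m+1)/2}`. -/
def posDefCoords (m : ℕ) : Set (UpperIdx m → ℝ) := {ξ | (symMat ξ).PosDef}

/-- Lebesgue measure `∏_{i ≤ j} dx_{ij}` on the cone of positive definite matrices. -/
def posDefVolume (m : ℕ) : Measure (UpperIdx m → ℝ) := volume.restrict (posDefCoords m)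

/-- The duplication matrix `D_m`. -/
def duplicationMatrix (m : ℕ) : Matrix (Fin m × Fin m) (UpperIdx m) ℝ :=
  Matrix.of fun r q => if upperIdx r.1 r.2 = q then 1 else 0

theorem symMat_nu {m : ℕ} {A : Matrix (Fin m) (Fin m) ℝ} (hA : A.IsSymm) :
    symMat (nu A) = A := by
  ext i j
  rcases le_total i j with h | h
  · simp [symMat, nu, upperIdx, h]
  · simp [symMat, nu, upperIdx, h, hA.apply i j]

theorem nu_symMat {m : ℕ} (ξ : UpperIdx m → ℝ) : nu (symMat ξ) = ξ := by
  ext ⟨⟨i, j⟩, h⟩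
  have h' : i ≤ j := h
  simp [symMat, nu, upperIdx, h']

theorem symMat_isSymm {m : ℕ} (ξ : UpperIdx m → ℝ) : (symMat ξ).IsSymm := by
  ext i j
  simp [symMat, upperIdx, min_comm, max_comm]

/-- `D_m` is the unique matrix with `D_m ν(A) = vec(A)` for every symmetric `A`. -/
theorem eq_duplicationMatrix_iff {m : ℕ} (D : Matrix (Fin m × Fin m) (UpperIdx m) ℝ) :
    (∀ A : Matrix (Fin m) (Fin m) ℝ, A.IsSymm → D *ᵥ nu A = vec A) ↔
      D = duplicationMatrix m := by
  have key : ∀ A : Matrix (Fin m) (Fin m) ℝ, A.IsSymm →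
      duplicationMatrix m *ᵥ nu A = vec A := by
    intro A hA
    ext ⟨i, j⟩
    have h := congrFun (congrFun (symMat_nu hA) i) j
    rw [← hA.apply i j] at h
    simpa [mulVec, dotProduct, duplicationMatrix, vec, symMat] using h
  constructor
  · intro h
    apply Matrix.ext_of_mulVec_single
    intro q
    have h1 := h _ (symMat_isSymm (Pi.single q 1))
    have h2 := key _ (symMat_isSymm (Pi.single q 1))
    rw [nu_symMat] at h1 h2
    rw [h1, h2]
  · rintro rfl
    exact key

/-! ### Wishart and inverse Wishart families -/

/-- `Γ_m(z) = π^{m(m-1)/4} ∏_{j=1}^m Γ(z + (1-j)/2)`. -/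
def multivariateGamma (m : ℕ) (z : ℝ) : ℝ :=
  Real.pi ^ ((m : ℝ) * ((m : ℝ) - 1) / 4) *
    ∏ j ∈ Finset.Icc 1 m, Real.Gamma (z + (1 - (j : ℝ)) / 2)

/-- The density of the Wishart distribution with `n` degrees of freedom and parameter `S`. -/
def wishartPDF {m : ℕ} (n : ℕ) (S X : Matrix (Fin m) (Fin m) ℝ) : ℝ :=
  X.det ^ (((n : ℝ) - m - 1) / 2) * Real.exp (-(1 / 2) * (S⁻¹ * X).trace) /
    (2 ^ ((n : ℝ) * m / 2) * S.det ^ ((n : ℝ) / 2) * multivariateGamma m ((n : ℝ) / 2))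

/-- The density of the inverse Wishart distribution with `n` degrees of freedom and
parameter `S`. -/
def invWishartPDF {m : ℕ} (n : ℕ) (S X : Matrix (Fin m) (Fin m) ℝ) : ℝ :=
  S.det ^ ((n : ℝ) / 2) * X.det ^ (-((n : ℝ) + m + 1) / 2) *
      Real.exp (-(1 / 2) * (S * X⁻¹).trace) /
    (2 ^ ((n : ℝ) * m / 2) * multivariateGamma m ((n : ℝ) / 2))

/-- The Wishart family in coordinates, on the parameter space and on the sample space. -/
def wishartModel (m n : ℕ) (ξ x : UpperIdx m → ℝ) : ℝ := wishartPDF n (symMat ξ) (symMat x)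

/-- The inverse Wishart family in coordinates, on the parameter space and on the sample space. -/
def invWishartModel (m n : ℕ) (ξ x : UpperIdx m → ℝ) : ℝ :=
  invWishartPDF n (symMat ξ) (symMat x)

/-- The Wishart law with parameter `S`, in coordinates. -/
def wishartMeasure {m : ℕ} (n : ℕ) (S : Matrix (Fin m) (Fin m) ℝ) :
    Measure (UpperIdx m → ℝ) :=
  (posDefVolume m).withDensity fun x => ENNReal.ofReal (wishartModel m n (nu S) x)

/-- The inverse Wishart law with parameter `S`, in coordinates. -/
def invWishartMeasure {m : ℕ} (n : ℕ) (S : Matrix (Fin m) (Fin m) ℝ) :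
    Measure (UpperIdx m → ℝ) :=
  (posDefVolume m).withDensity fun x => ENNReal.ofReal (invWishartModel m n (nu S) x)

/-- Matrix inversion `X ↦ X⁻¹` in coordinates. -/
def invCoords {m : ℕ} (x : UpperIdx m → ℝ) : UpperIdx m → ℝ := nu (symMat x)⁻¹

/-- The Fisher–Rao distance of the inverse Wishart family. -/
def invWishartDist {m : ℕ} (n : ℕ) (S₁ S₂ : Matrix (Fin m) (Fin m) ℝ) : ℝ :=
  fisherRaoDist (posDefCoords m) (posDefVolume m) (invWishartModel m n) (nu S₁) (nu S₂)

/-! ### Matrix functions -/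

/-- The logarithm of a positive definite matrix, through the spectral functional calculus. -/
def matLog {m : ℕ} (A : Matrix (Fin m) (Fin m) ℝ) : Matrix (Fin m) (Fin m) ℝ := cfc Real.log A

/-- `A^{-1/2}` for a positive definite matrix `A`, through the spectral functional calculus. -/
def invSqrt {m : ℕ} (A : Matrix (Fin m) (Fin m) ℝ) : Matrix (Fin m) (Fin m) ℝ :=
  cfc (fun x : ℝ => x ^ (-(1 / 2) : ℝ)) A

/-- The Frobenius norm `√tr(A Aᵀ)`. -/
def frobNorm {m : ℕ} (A : Matrix (Fin m) (Fin m) ℝ) : ℝ := √(A * Aᵀ).trace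

end FisherRao

end

open FisherRao

/-! The three claims meet in the affine-invariant form tr(A⁻¹VA⁻¹V), called `metricSq`.

Laws: the congruence X ↦ AXAᵀ by a symmetric A has Jacobian (det A)^(m+1) (`det_congrCoords`).
Inversion has differential V ↦ -X⁻¹VX⁻¹, so its absolute Jacobian is (det X)^(-(m+1)), exactly the
factor that exchanges the two densities. The total mass is the multivariate gamma integral
`lintegral_gammaIntegrand`, computed by induction on m with Schur complements.

Fisher matrices: up to sign, the scores of both families are centred traces ½ tr(HY) - (n/2) tr(HΦ)
of a Wishart matrix Y with parameter Φ. The logarithm of the moment generating function of tr(HY) is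
-(n/2) ∑ log(1 - 2t cₖ), where H and Φ are diagonalized simultaneously. Its second derivative at 0
is the variance (`wishart_trace_variance`), and polarization yields the covariances.

Distance: write Σ₁ = BBᵀ and Σ₂ = B diag(d) Bᵀ. The curve B diag(dᵗ) Bᵀ has constant speed √(∑ log²
dₖ) for `metricSq`, which gives the upper bound. The lower bound uses a calibrating function in
place of geodesic theory: `logPivots`, the sum ∑ lₖ log(pivotₖ) over the pivots of Gaussian
elimination, changes along any curve at a rate of at most √(∑ lₖ²) times the speed
(`hasDerivAt_logPivots`, resting on `le_metricSq`). After the congruence by B⁻¹ the endpoints are 1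
and diag(d). The weights lₖ = log dₖ make the increment ∑ log² dₖ, so every admissible curve has
length at least √(∑ log² dₖ). -/

noncomputable section

namespace FisherRao

/-! ### Linear coordinates and the Jacobian of congruences. -/

section

variable {m : ℕ}

theorem symMat_apply (ξ : UpperIdx m → ℝ) (i j : Fin m) : symMat ξ i j = ξ (upperIdx i j) := rfl

theorem upperIdx_of_le {i j : Fin m} (h : i ≤ j) : upperIdx i j = ⟨(i, j), h⟩ := by
  simp [upperIdx, h]

/-- `ξ ↦ symMat ξ` as a linear map. -/
def symMatL (m : ℕ) : (UpperIdx m → ℝ) →ₗ[ℝ] Matrix (Fin m) (Fin m) ℝ where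
  toFun := symMat
  map_add' _ _ := rfl
  map_smul' _ _ := rfl

/-- `A ↦ nu A` as a linear map. -/
def nuL (m : ℕ) : Matrix (Fin m) (Fin m) ℝ →ₗ[ℝ] (UpperIdx m → ℝ) where
  toFun := nu
  map_add' _ _ := rfl
  map_smul' _ _ := rfl

/-- The congruence `X ↦ A X Aᵀ` on symmetric matrices, in coordinates. -/
def congrCoords (A : Matrix (Fin m) (Fin m) ℝ) : (UpperIdx m → ℝ) →ₗ[ℝ] (UpperIdx m → ℝ) where
  toFun ξ := nu (A * symMat ξ * Aᵀ)
  map_add' ξ η := by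
    rw [show symMat (ξ + η) = symMat ξ + symMat η from rfl, Matrix.mul_add, Matrix.add_mul]; rfl
  map_smul' c ξ := by
    rw [show symMat (c • ξ) = c • symMat ξ from rfl, Matrix.mul_smul, Matrix.smul_mul]; rfl

theorem congrCoords_apply (A : Matrix (Fin m) (Fin m) ℝ) (ξ : UpperIdx m → ℝ) :
    congrCoords A ξ = nu (A * symMat ξ * Aᵀ) := rfl

theorem symMat_congrCoords (A : Matrix (Fin m) (Fin m) ℝ) (ξ : UpperIdx m → ℝ) :
    symMat (congrCoords A ξ) = A * symMat ξ * Aᵀ := by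
  rw [congrCoords_apply]
  apply symMat_nu
  rw [Matrix.IsSymm, transpose_mul, transpose_mul, transpose_transpose, (symMat_isSymm ξ).eq,
    Matrix.mul_assoc]

theorem congrCoords_mul (A B : Matrix (Fin m) (Fin m) ℝ) :
    congrCoords (A * B) = congrCoords A ∘ₗ congrCoords B := by
  apply LinearMap.ext
  intro ξ
  simp only [LinearMap.comp_apply, congrCoords_apply (A * B), congrCoords_apply A,
    symMat_congrCoords, transpose_mul, Matrix.mul_assoc]

theorem congrCoords_one : congrCoords (1 : Matrix (Fin m) (Fin m) ℝ) = LinearMap.id := by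
  apply LinearMap.ext
  intro ξ
  simp [congrCoords_apply, nu_symMat]

/-- Swapping the names in the second factors turns the product over i ≤ j into one over all pairs
(i, j), each contributing dᵢ once and the diagonal pairs once more. Hence each dᵢ occurs m + 1
times. -/
theorem prod_upperIdx_mul (d : Fin m → ℝ) :
    ∏ q : UpperIdx m, d q.1.1 * d q.1.2 = (∏ i, d i) ^ (m + 1) := by
  have h1 : ∏ q : UpperIdx m, d q.1.1 * d q.1.2
      = ∏ p : Fin m × Fin m, if p.1 ≤ p.2 then d p.1 * d p.2 else 1 := by
    rw [← Finset.prod_filter]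
    exact (Finset.prod_subtype _ (by simp) fun p : Fin m × Fin m => d p.1 * d p.2).symm
  rw [h1]
  have h2 : ∀ p : Fin m × Fin m, (if p.1 ≤ p.2 then d p.1 * d p.2 else 1)
      = (if p.1 ≤ p.2 then d p.1 else 1) * (if p.1 ≤ p.2 then d p.2 else 1) := by
    intro p; split_ifs <;> simp
  have h3 : ∏ p : Fin m × Fin m, (if p.1 ≤ p.2 then d p.2 else 1)
      = ∏ p : Fin m × Fin m, (if p.2 ≤ p.1 then d p.1 else 1) :=
    Fintype.prod_equiv (Equiv.prodComm _ _) _ _ (fun _ => rfl)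
  have h4 : ∀ p : Fin m × Fin m, (if p.1 ≤ p.2 then d p.1 else 1) * (if p.2 ≤ p.1 then d p.1 else 1)
      = d p.1 * (if p.1 = p.2 then d p.1 else 1) := by
    rintro ⟨i, j⟩
    rcases lt_trichotomy i j with h | h | h
    · simp [h.le, h.ne, h.not_ge]
    · simp [h]
    · simp [h.le, h.ne', h.not_ge]
  rw [Finset.prod_congr rfl (fun p _ => h2 p), Finset.prod_mul_distrib, h3,
    ← Finset.prod_mul_distrib, Finset.prod_congr rfl (fun p _ => h4 p), Finset.prod_mul_distrib,
    Fintype.prod_prod_type, Fintype.prod_prod_type]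
  simp [Finset.prod_pow, pow_succ]

theorem det_congrCoords_diagonal (d : Fin m → ℝ) :
    LinearMap.det (congrCoords (diagonal d)) = (∏ i, d i) ^ (m + 1) := by
  have h : congrCoords (diagonal d)
      = Matrix.toLin' (diagonal fun q : UpperIdx m => d q.1.1 * d q.1.2) := by
    apply LinearMap.ext
    intro ξ
    ext ⟨⟨i, j⟩, hij⟩
    have hij' : i ≤ j := hij
    simp only [congrCoords_apply, nu, diagonal_transpose, mul_diagonal, diagonal_mul,
      symMat_apply, upperIdx_of_le hij', toLin'_apply, mulVec_diagonal]
    ring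
  rw [h, LinearMap.det_toLin', det_diagonal, prod_upperIdx_mul]

/-- Spectral decomposition of a real symmetric matrix and of its functional calculus. -/
theorem cfc_eq_mul_diagonal_mul {A : Matrix (Fin m) (Fin m) ℝ} (hA : A.IsHermitian) :
    ∃ U : Matrix (Fin m) (Fin m) ℝ, U * Uᵀ = 1 ∧ Uᵀ * U = 1 ∧
      A = U * diagonal hA.eigenvalues * Uᵀ ∧
      ∀ f : ℝ → ℝ, cfc f A = U * diagonal (fun k => f (hA.eigenvalues k)) * Uᵀ := by
  refine ⟨hA.eigenvectorUnitary, Unitary.coe_mul_star_self hA.eigenvectorUnitary,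
    Unitary.coe_star_mul_self hA.eigenvectorUnitary, ?_, fun f => ?_⟩
  · conv_lhs => rw [hA.spectral_theorem]
    rfl
  · rw [hA.cfc_eq]
    rfl

/-- By the spectral theorem the congruence factors through U, a diagonal matrix and Uᵀ. The
determinants belonging to U and Uᵀ are inverse to each other, so only the diagonal factor counts;
there the coordinate (i, j) is scaled by dᵢdⱼ. -/
theorem det_congrCoords {A : Matrix (Fin m) (Fin m) ℝ} (hA : A.IsHermitian) :
    LinearMap.det (congrCoords A) = A.det ^ (m + 1) := by
  obtain ⟨U, h1, h2, h3, -⟩ := cfc_eq_mul_diagonal_mul hA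
  have hU : LinearMap.det (congrCoords U) * LinearMap.det (congrCoords Uᵀ) = 1 := by
    rw [← LinearMap.det_comp, ← congrCoords_mul, h1, congrCoords_one, LinearMap.det_id]
  have hdet : A.det = ∏ i, hA.eigenvalues i := by simpa using hA.det_eq_prod_eigenvalues
  have h4 : congrCoords A = congrCoords (U * diagonal hA.eigenvalues * Uᵀ) := congrArg _ h3
  rw [hdet, h4, congrCoords_mul, congrCoords_mul, LinearMap.det_comp, LinearMap.det_comp,
    det_congrCoords_diagonal]
  linear_combination (∏ i, hA.eigenvalues i) ^ (m + 1) * hU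

/-! ### The open cone of positive definite matrices, and inversion on it. -/

theorem isHermitian_symMat (ξ : UpperIdx m → ℝ) : (symMat ξ).IsHermitian := symMat_isSymm ξ

theorem continuous_symMat : Continuous (symMat : (UpperIdx m → ℝ) → _) :=
  continuous_matrix fun _ _ => continuous_apply _

theorem posDef_iff_sphere {A : Matrix (Fin m) (Fin m) ℝ} (hA : A.IsHermitian) :
    A.PosDef ↔ ∀ x ∈ Metric.sphere (0 : Fin m → ℝ) 1, 0 < x ⬝ᵥ (A *ᵥ x) := by
  rw [posDef_iff_dotProduct_mulVec]
  simp only [hA, true_and, star_trivial]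
  constructor
  · intro h x hx
    exact h (by rintro rfl; simp at hx)
  · intro h x hx
    have hn : 0 < ‖x‖ := norm_pos_iff.mpr hx
    have := h (‖x‖⁻¹ • x) (by simp [norm_smul, hn.ne'])
    rw [mulVec_smul, smul_dotProduct, dotProduct_smul, smul_eq_mul, smul_eq_mul] at this
    exact (mul_pos_iff_of_pos_left (inv_pos.mpr hn)).mp
      ((mul_pos_iff_of_pos_left (inv_pos.mpr hn)).mp this)

/-- Positivity need only be tested on the compact unit sphere. The complement is therefore the
projection, along a compact factor, of a closed set of pairs (vector, matrix). -/
theorem isOpen_posDefCoords : IsOpen (posDefCoords m) := by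
  rw [← isClosed_compl_iff]
  have : (posDefCoords m)ᶜ = Prod.snd '' {p : Metric.sphere (0 : Fin m → ℝ) 1 × (UpperIdx m → ℝ) |
      (p.1 : Fin m → ℝ) ⬝ᵥ (symMat p.2 *ᵥ p.1) ≤ 0} := by
    ext ξ
    simp [posDefCoords, posDef_iff_sphere (isHermitian_symMat ξ)]
  rw [this]
  refine isClosedMap_snd_of_compactSpace _ (isClosed_le ?_ continuous_const)
  have h1 : Continuous fun p : Metric.sphere (0 : Fin m → ℝ) 1 × (UpperIdx m → ℝ) => symMat p.2 :=
    continuous_symMat.comp continuous_snd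
  fun_prop

theorem measurableSet_posDefCoords : MeasurableSet (posDefCoords m) :=
  isOpen_posDefCoords.measurableSet

theorem symMat_invCoords (ξ : UpperIdx m → ℝ) : symMat (invCoords ξ) = (symMat ξ)⁻¹ := by
  apply symMat_nu
  rw [Matrix.IsSymm, transpose_nonsing_inv, (symMat_isSymm ξ).eq]

section inverse

open scoped Matrix.Norms.Operator

theorem hasFDerivAt_matrix_inv {A : Matrix (Fin m) (Fin m) ℝ} (hA : IsUnit A) :
    HasFDerivAt (fun X : Matrix (Fin m) (Fin m) ℝ => X⁻¹)
      (-ContinuousLinearMap.mulLeftRight ℝ _ A⁻¹ A⁻¹) A := by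
  have h := hasFDerivAt_ringInverse (𝕜 := ℝ) hA.unit
  have h1 : (Ring.inverse : Matrix (Fin m) (Fin m) ℝ → _) = fun X => X⁻¹ := by
    ext1 X; exact (nonsing_inv_eq_ringInverse X).symm
  rw [h1, coe_units_inv] at h
  exact h

/-- The differential V ↦ -S⁻¹VS⁻¹ is minus a congruence, so its Jacobian is covered by
`det_congrCoords`. -/
theorem hasFDerivAt_invCoords {ξ : UpperIdx m → ℝ} (hξ : ξ ∈ posDefCoords m) :
    HasFDerivAt invCoords
      (-LinearMap.toContinuousLinearMap (congrCoords (symMat ξ)⁻¹)) ξ := by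
  have h := hasFDerivAt_matrix_inv (show IsUnit (symMat ξ) from PosDef.isUnit hξ)
  have h1 : HasFDerivAt (symMat : (UpperIdx m → ℝ) → _)
      (LinearMap.toContinuousLinearMap (symMatL m)) ξ :=
    (LinearMap.toContinuousLinearMap (symMatL m)).hasFDerivAt
  have h2 := (LinearMap.toContinuousLinearMap (nuL m)).hasFDerivAt (x := (symMat ξ)⁻¹)
  refine ((h2.comp ξ (h.comp ξ h1))).congr_fderiv ?_
  ext1 v
  simp only [congrCoords, transpose_nonsing_inv, (symMat_isSymm ξ).eq]
  rfl

theorem continuousAt_matrix_inv {A : Matrix (Fin m) (Fin m) ℝ} (hA : IsUnit A) :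
    ContinuousAt (fun X : Matrix (Fin m) (Fin m) ℝ => X⁻¹) A :=
  (hasFDerivAt_matrix_inv hA).continuousAt

end inverse

theorem measurable_det_symMat : Measurable fun x : UpperIdx m → ℝ => (symMat x).det :=
  (continuous_symMat.matrix_det).measurable

/-- The formula adjugate over determinant holds everywhere: at singular matrices both the matrix
inverse and the scalar det⁻¹ take the value 0. -/
theorem measurable_invCoords : Measurable (invCoords : (UpperIdx m → ℝ) → _) := by
  refine measurable_pi_iff.mpr fun q => ?_
  have h : ∀ x : UpperIdx m → ℝ, invCoords x q
      = (symMat x).det⁻¹ * (symMat x).adjugate q.1.1 q.1.2 := by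
    intro x
    simp [invCoords, nu, Matrix.inv_def, Ring.inverse_eq_inv']
  simp only [h]
  exact measurable_det_symMat.inv.mul
    ((continuous_symMat.matrix_adjugate).matrix_elem _ _).measurable

end

section

variable {m : ℕ}

/-! ### Bordered matrices and Schur complements -/

/-- The matrix with corner `p`, first row `r`, first column `s` and remaining block `Q`. -/
def bordered (p : ℝ) (r s : Fin m → ℝ) (Q : Matrix (Fin m) (Fin m) ℝ) :
    Matrix (Fin (m + 1)) (Fin (m + 1)) ℝ :=
  Matrix.of (Fin.cons (Fin.cons p r) fun i => Fin.cons (s i) (Q i))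

@[simp] theorem bordered_zero_zero (p : ℝ) (r s : Fin m → ℝ) (Q : Matrix (Fin m) (Fin m) ℝ) :
    bordered p r s Q 0 0 = p := rfl

@[simp] theorem bordered_zero_succ (p : ℝ) (r s : Fin m → ℝ) (Q : Matrix (Fin m) (Fin m) ℝ)
    (j : Fin m) : bordered p r s Q 0 j.succ = r j := rfl

@[simp] theorem bordered_succ_zero (p : ℝ) (r s : Fin m → ℝ) (Q : Matrix (Fin m) (Fin m) ℝ)
    (i : Fin m) : bordered p r s Q i.succ 0 = s i := rfl

@[simp] theorem bordered_succ_succ (p : ℝ) (r s : Fin m → ℝ) (Q : Matrix (Fin m) (Fin m) ℝ)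
    (i j : Fin m) : bordered p r s Q i.succ j.succ = Q i j := rfl

theorem ext_bordered {A B : Matrix (Fin (m + 1)) (Fin (m + 1)) ℝ} (h00 : A 0 0 = B 0 0)
    (h0 : ∀ j : Fin m, A 0 j.succ = B 0 j.succ) (h1 : ∀ i : Fin m, A i.succ 0 = B i.succ 0)
    (h : ∀ i j : Fin m, A i.succ j.succ = B i.succ j.succ) : A = B := by
  ext i j
  refine Fin.cases ?_ (fun i => ?_) i <;> refine Fin.cases ?_ (fun j => ?_) j
  exacts [h00, h0 j, h1 i, h i j]

theorem bordered_mul (p p' : ℝ) (r s r' s' : Fin m → ℝ) (Q Q' : Matrix (Fin m) (Fin m) ℝ) :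
    bordered p r s Q * bordered p' r' s' Q' =
      bordered (p * p' + r ⬝ᵥ s') (p • r' + r ᵥ* Q') (p' • s + Q *ᵥ s')
        (vecMulVec s r' + Q * Q') := by
  apply ext_bordered <;> intros <;>
    simp [mul_apply, Fin.sum_univ_succ, dotProduct, vecMul, mulVec, vecMulVec_apply, mul_comm]

theorem bordered_transpose (p : ℝ) (r s : Fin m → ℝ) (Q : Matrix (Fin m) (Fin m) ℝ) :
    (bordered p r s Q)ᵀ = bordered p s r Qᵀ := by
  apply ext_bordered <;> intros <;> rfl

theorem bordered_one : bordered 1 0 0 (1 : Matrix (Fin m) (Fin m) ℝ) = 1 := by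
  apply ext_bordered <;> intros <;> simp [one_apply, Fin.succ_ne_zero, (Fin.succ_ne_zero _).symm]

theorem trace_bordered (p : ℝ) (r s : Fin m → ℝ) (Q : Matrix (Fin m) (Fin m) ℝ) :
    (bordered p r s Q).trace = p + Q.trace := by
  simp [trace, Fin.sum_univ_succ]

theorem det_bordered_zero (p : ℝ) (s : Fin m → ℝ) (Q : Matrix (Fin m) (Fin m) ℝ) :
    (bordered p 0 s Q).det = p * Q.det := by
  rw [det_succ_row_zero, Fin.sum_univ_succ]
  have : (bordered p 0 s Q).submatrix Fin.succ Fin.succ = Q := rfl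
  simp [this]

/-- The Schur complement of the upper left entry. -/
def schur (A : Matrix (Fin (m + 1)) (Fin (m + 1)) ℝ) : Matrix (Fin m) (Fin m) ℝ :=
  Matrix.of fun i j => A i.succ j.succ - A i.succ 0 * A 0 j.succ / A 0 0

/-- The derivative of the Schur complement at `A` in the direction `V`. -/
def schurDeriv (A V : Matrix (Fin (m + 1)) (Fin (m + 1)) ℝ) : Matrix (Fin m) (Fin m) ℝ :=
  Matrix.of fun i j => V i.succ j.succ - (V i.succ 0 * A 0 j.succ + A i.succ 0 * V 0 j.succ) / A 0 0
    + A i.succ 0 * A 0 j.succ * V 0 0 / A 0 0 ^ 2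

/-- The unipotent matrix that eliminates the first column of `A`. -/
def elimination (A : Matrix (Fin (m + 1)) (Fin (m + 1)) ℝ) :
    Matrix (Fin (m + 1)) (Fin (m + 1)) ℝ :=
  bordered 1 0 (fun i => -(A i.succ 0 / A 0 0)) 1

theorem det_elimination (A : Matrix (Fin (m + 1)) (Fin (m + 1)) ℝ) : (elimination A).det = 1 := by
  simp [elimination, det_bordered_zero]

theorem bordered_eta (A : Matrix (Fin (m + 1)) (Fin (m + 1)) ℝ) :
    A = bordered (A 0 0) (fun j => A 0 j.succ) (fun i => A i.succ 0)
      (Matrix.of fun i j => A i.succ j.succ) := by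
  apply ext_bordered <;> intros <;> rfl

/-- Eliminating with the multipliers of A while transforming a tangent vector V leaves the
derivative of the Schur complement in the lower block. This makes the metric compatible with one
step of Gaussian elimination. -/
theorem elimination_mul_mul (A V : Matrix (Fin (m + 1)) (Fin (m + 1)) ℝ) (hA : A.IsSymm)
    (hV : V.IsSymm) : elimination A * V * (elimination A)ᵀ =
      bordered (V 0 0) (fun j => V 0 j.succ - V 0 0 * A 0 j.succ / A 0 0)
        (fun j => V 0 j.succ - V 0 0 * A 0 j.succ / A 0 0) (schurDeriv A V) := by
  conv_lhs => rw [bordered_eta V]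
  rw [elimination, bordered_mul, bordered_transpose, bordered_mul]
  have hA' : ∀ i : Fin m, A i.succ 0 = A 0 i.succ := fun i => hA.apply 0 i.succ
  have hV' : ∀ i : Fin m, V i.succ 0 = V 0 i.succ := fun i => hV.apply 0 i.succ
  apply ext_bordered <;> intros <;>
    simp [hA', hV', schurDeriv, vecMulVec_apply] <;> ring

theorem schurDeriv_self {A : Matrix (Fin (m + 1)) (Fin (m + 1)) ℝ} (h : A 0 0 ≠ 0) :
    schurDeriv A A = schur A := by
  ext i j
  simp only [schurDeriv, schur, of_apply]
  field_simp
  ring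

theorem elimination_mul_self_mul {A : Matrix (Fin (m + 1)) (Fin (m + 1)) ℝ} (hA : A.IsSymm)
    (h : A 0 0 ≠ 0) :
    elimination A * A * (elimination A)ᵀ = bordered (A 0 0) 0 0 (schur A) := by
  rw [elimination_mul_mul A A hA hA, schurDeriv_self h]
  apply ext_bordered <;> intros <;> simp <;> field_simp <;> simp

theorem det_eq_mul_det_schur {A : Matrix (Fin (m + 1)) (Fin (m + 1)) ℝ} (hA : A.IsSymm)
    (h : A 0 0 ≠ 0) : A.det = A 0 0 * (schur A).det := by
  have := congrArg det (elimination_mul_self_mul hA h)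
  rwa [det_mul, det_mul, det_transpose, det_elimination, det_bordered_zero, one_mul, mul_one] at this

theorem isUnit_elimination (A : Matrix (Fin (m + 1)) (Fin (m + 1)) ℝ) :
    IsUnit (elimination A) := by
  rw [isUnit_iff_isUnit_det, det_elimination]; exact isUnit_one

theorem posDef_bordered {a : ℝ} {S : Matrix (Fin m) (Fin m) ℝ} :
    (bordered a 0 0 S).PosDef ↔ 0 < a ∧ S.PosDef := by
  constructor
  · intro h
    refine ⟨h.diag_pos (i := 0), ?_⟩
    have := h.submatrix (Fin.succ_injective m)
    exact this
  · rintro ⟨ha, hS⟩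
    rw [posDef_iff_dotProduct_mulVec]
    refine ⟨?_, fun x hx => ?_⟩
    · rw [IsHermitian, conjTranspose_eq_transpose_of_trivial, bordered_transpose]
      rw [← conjTranspose_eq_transpose_of_trivial, hS.1.eq]
    · have hq : star x ⬝ᵥ (bordered a 0 0 S *ᵥ x) =
          a * x 0 ^ 2 + (Fin.tail x) ⬝ᵥ (S *ᵥ Fin.tail x) := by
        simp [dotProduct, mulVec, Fin.sum_univ_succ, Fin.tail]
        ring
      rw [hq]
      by_cases h0 : Fin.tail x = 0
      · have hx0 : x 0 ≠ 0 := by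
          intro h
          apply hx
          ext i
          refine Fin.cases h (fun i => ?_) i
          exact congrFun h0 i
        rw [h0]
        simp only [mulVec_zero, dotProduct_zero, add_zero]
        positivity
      · have := hS.dotProduct_mulVec_pos h0
        rw [star_trivial] at this
        positivity

theorem posDef_iff_schur {A : Matrix (Fin (m + 1)) (Fin (m + 1)) ℝ} (hA : A.IsSymm) :
    A.PosDef ↔ 0 < A 0 0 ∧ (schur A).PosDef := by
  -- Elimination needs a nonzero pivot; each side of the equivalence supplies one.
  have key : A 0 0 ≠ 0 → (A.PosDef ↔ 0 < A 0 0 ∧ (schur A).PosDef) := by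
    intro h
    rw [← posDef_bordered, ← elimination_mul_self_mul hA h,
      ← conjTranspose_eq_transpose_of_trivial]
    exact (Matrix.IsUnit.posDef_star_right_conjugate_iff (isUnit_elimination A)).symm
  constructor
  · intro h
    exact (key (h.diag_pos (i := 0)).ne').mp h
  · intro h
    exact (key h.1.ne').mpr h

/-! ### The affine-invariant metric -/

/-- The square `tr (A⁻¹ V A⁻¹ V)` of the affine-invariant norm of `V` at `A`. -/
def metricSq (A V : Matrix (Fin m) (Fin m) ℝ) : ℝ := (A⁻¹ * V * A⁻¹ * V).trace

/-- The matrix under the trace is merely conjugated by Lᵀ. Invertible congruences thus act as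
isometries, which permits both elimination and the normalization of endpoints. -/
theorem metricSq_congr {L : Matrix (Fin m) (Fin m) ℝ} (hL : IsUnit L)
    (A V : Matrix (Fin m) (Fin m) ℝ) :
    metricSq (L * A * Lᵀ) (L * V * Lᵀ) = metricSq A V := by
  have h1 : IsUnit L.det := (isUnit_iff_isUnit_det L).mp hL
  have h2 : IsUnit Lᵀ.det := by rwa [det_transpose]
  have e1 : ∀ M, L⁻¹ * (L * M) = M := fun M => by
    rw [← Matrix.mul_assoc, nonsing_inv_mul _ h1, Matrix.one_mul]
  have e2 : ∀ M, Lᵀ * (Lᵀ⁻¹ * M) = M := fun M => by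
    rw [← Matrix.mul_assoc, mul_nonsing_inv _ h2, Matrix.one_mul]
  simp only [metricSq, Matrix.mul_inv_rev, Matrix.mul_assoc, e1, e2]
  rw [trace_mul_comm]
  simp only [Matrix.mul_assoc, mul_nonsing_inv _ h2, Matrix.mul_one]

theorem metricSq_bordered {a : ℝ} {S : Matrix (Fin m) (Fin m) ℝ} (ha : a ≠ 0) (hS : IsUnit S)
    (p : ℝ) (r : Fin m → ℝ) (Q : Matrix (Fin m) (Fin m) ℝ) :
    metricSq (bordered a 0 0 S) (bordered p r r Q) =
      (p / a) ^ 2 + 2 * (r ⬝ᵥ (S⁻¹ *ᵥ r)) / a + metricSq S Q := by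
  have hinv : (bordered a 0 0 S)⁻¹ = bordered a⁻¹ 0 0 S⁻¹ := by
    apply inv_eq_right_inv
    rw [bordered_mul, ← bordered_one]
    apply ext_bordered <;> intros <;>
      simp [ha, mul_nonsing_inv _ ((isUnit_iff_isUnit_det S).mp hS)]
  rw [metricSq, hinv, Matrix.mul_assoc, bordered_mul, bordered_mul, trace_bordered, trace_add,
    trace_vecMulVec, metricSq]
  simp only [zero_dotProduct, add_zero, zero_vecMul, smul_zero, zero_add,
    Matrix.mul_assoc, smul_dotProduct, dotProduct_smul, smul_eq_mul, zero_vecMulVec]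
  rw [dotProduct_comm (S⁻¹ *ᵥ r) r]
  field_simp
  ring

theorem schurDeriv_isSymm {A V : Matrix (Fin (m + 1)) (Fin (m + 1)) ℝ} (hA : A.IsSymm)
    (hV : V.IsSymm) : (schurDeriv A V).IsSymm := by
  ext i j
  simp only [transpose_apply, schurDeriv, of_apply, hV.apply i.succ j.succ, hA.apply i.succ 0,
    hA.apply j.succ 0, hV.apply i.succ 0, hV.apply j.succ 0]
  ring

/-- After elimination the metric splits into a pivot term, a term for the off-diagonal row and the
metric of the Schur complement. The row term 2 rᵀS⁻¹r / A₀₀ is nonnegative and is dropped. -/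
theorem le_metricSq {A V : Matrix (Fin (m + 1)) (Fin (m + 1)) ℝ} (hA : A.PosDef)
    (hV : V.IsSymm) :
    (V 0 0 / A 0 0) ^ 2 + metricSq (schur A) (schurDeriv A V) ≤ metricSq A V := by
  have hs : A.IsSymm := hA.1
  obtain ⟨h0, hS⟩ := (posDef_iff_schur hs).mp hA
  rw [← metricSq_congr (isUnit_elimination A) A V, elimination_mul_self_mul hs h0.ne',
    elimination_mul_mul A V hs hV, metricSq_bordered h0.ne' hS.isUnit]
  have := hS.inv.posSemidef.dotProduct_mulVec_nonneg
    (fun j => V 0 j.succ - V 0 0 * A 0 j.succ / A 0 0)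
  rw [star_trivial] at this
  have : 0 ≤ 2 * ((fun j => V 0 j.succ - V 0 0 * A 0 j.succ / A 0 0) ⬝ᵥ
    ((schur A)⁻¹ *ᵥ fun j => V 0 j.succ - V 0 0 * A 0 j.succ / A 0 0)) / A 0 0 := by positivity
  linarith

theorem metricSq_nonneg {A V : Matrix (Fin m) (Fin m) ℝ} (hA : A.PosDef) (hV : V.IsSymm) :
    0 ≤ metricSq A V := by
  induction m with
  | zero => simp [metricSq]
  | succ m ih =>
    have hs : A.IsSymm := hA.1
    have := ih ((posDef_iff_schur hs).mp hA).2 (schurDeriv_isSymm hs hV)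
    have := le_metricSq hA hV
    nlinarith [sq_nonneg (V 0 0 / A 0 0)]

/-- The function `∑ k, l k * log (pivot k)` of the pivots of Gaussian elimination. Up to a
factor it is a Busemann function of the cone of positive definite matrices. -/
def logPivots : {m : ℕ} → (Fin m → ℝ) → Matrix (Fin m) (Fin m) ℝ → ℝ
  | 0, _, _ => 0
  | _ + 1, l, A => l 0 * Real.log (A 0 0) + logPivots (Fin.tail l) (schur A)

theorem logPivots_diagonal (l d : Fin m → ℝ) :
    logPivots l (diagonal d) = ∑ k, l k * Real.log (d k) := by
  induction m with
  | zero => simp [logPivots]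
  | succ m ih =>
    have : schur (diagonal d) = diagonal (Fin.tail d) := by
      ext i j
      simp [schur, diagonal_apply, Fin.succ_ne_zero, Fin.tail]
    rw [logPivots, this, ih, Fin.sum_univ_succ]
    simp [Fin.tail]

theorem continuousOn_logPivots (l : Fin m → ℝ) {A : ℝ → Matrix (Fin m) (Fin m) ℝ} {s : Set ℝ}
    (hA : ∀ t ∈ s, (A t).PosDef) (hc : ∀ i j, ContinuousOn (fun t => A t i j) s) :
    ContinuousOn (fun t => logPivots l (A t)) s := by
  induction m with
  | zero => exact continuousOn_const
  | succ m ih =>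
    have h0 : ∀ t ∈ s, A t 0 0 ≠ 0 := fun t ht => ((hA t ht).diag_pos (i := 0)).ne'
    refine (continuousOn_const.mul ((hc 0 0).log h0)).add (ih _ ?_ ?_)
    · exact fun t ht => ((posDef_iff_schur (hA t ht).1).mp (hA t ht)).2
    · intro i j
      exact (hc _ _).sub (((hc _ _).mul (hc _ _)).div (hc 0 0) h0)

/-- Cauchy–Schwarz for the vectors (x, √P) and (y, √Q), with δ in place of √P √Q. The cross term is
handled by the inequality of arithmetic and geometric means for x²Q and y²P. -/
theorem add_mul_sq_le {x y δ P Q : ℝ} (hP : 0 ≤ P) (hQ : 0 ≤ Q) (h : δ ^ 2 ≤ P * Q) :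
    (x * y + δ) ^ 2 ≤ (x ^ 2 + P) * (y ^ 2 + Q) := by
  have h1 : 2 * (x * y * δ) ≤ x ^ 2 * Q + y ^ 2 * P := by
    refine (le_abs_self _).trans (abs_le_of_sq_le_sq ?_ (by positivity))
    nlinarith [sq_nonneg (x ^ 2 * Q - y ^ 2 * P), mul_le_mul_of_nonneg_left h (sq_nonneg (x * y))]
  nlinarith

/-- The gradient bound behind the lower estimate of lengths. Induction peels off one pivot: its
logarithmic derivative is V₀₀ / A₀₀, the rest is the derivative along the Schur complement, and
`add_mul_sq_le` combines them within the bound of `le_metricSq`. -/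
theorem hasDerivAt_logPivots (l : Fin m → ℝ) {A : ℝ → Matrix (Fin m) (Fin m) ℝ}
    {V : Matrix (Fin m) (Fin m) ℝ} {t : ℝ} (hs : ∀ u, (A u).IsSymm) (hA : (A t).PosDef)
    (hV : V.IsSymm) (hd : ∀ i j, HasDerivAt (fun u => A u i j) (V i j) t) :
    ∃ δ, HasDerivAt (fun u => logPivots l (A u)) δ t ∧
      δ ^ 2 ≤ (∑ k, l k ^ 2) * metricSq (A t) V := by
  induction m with
  | zero => exact ⟨0, hasDerivAt_const _ _, by simp⟩
  | succ m ih =>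
    have h0 : A t 0 0 ≠ 0 := (hA.diag_pos (i := 0)).ne'
    have hS := ((posDef_iff_schur (hs t)).mp hA).2
    obtain ⟨δ, h1, h2⟩ := ih (Fin.tail l) (A := fun u => schur (A u)) (V := schurDeriv (A t) V)
      (fun u => by
        ext i j
        simp only [transpose_apply, schur, of_apply, (hs u).apply i.succ j.succ,
          (hs u).apply i.succ 0, (hs u).apply j.succ 0]
        ring)
      hS (schurDeriv_isSymm (hs t) hV)
      (fun i j => by
        refine ((hd i.succ j.succ).sub
          (((hd i.succ 0).mul (hd 0 j.succ)).div (hd 0 0) h0)).congr_deriv ?_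
        simp only [schurDeriv, of_apply, Pi.mul_apply]
        field_simp
        ring)
    refine ⟨l 0 * (V 0 0 / A t 0 0) + δ, (((hd 0 0).log h0).const_mul (l 0)).add h1, ?_⟩
    rw [Fin.sum_univ_succ]
    refine (add_mul_sq_le (Finset.sum_nonneg fun k _ => sq_nonneg (Fin.tail l k))
      (metricSq_nonneg hS (schurDeriv_isSymm (hs t) hV)) h2).trans ?_
    exact mul_le_mul_of_nonneg_left (le_metricSq hA hV) (by positivity)

end

section

variable {m : ℕ}

/-! ### The multivariate gamma integral -/

/-- The upper triangle of size `m + 1` is its first row together with the upper triangle of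
size `m`. -/
def upperIdxSuccEquiv (m : ℕ) : Fin (m + 1) ⊕ UpperIdx m ≃ UpperIdx (m + 1) :=
  Equiv.ofBijective
    (Sum.elim (fun j => ⟨(0, j), Fin.zero_le j⟩)
      fun q => ⟨(q.1.1.succ, q.1.2.succ), Fin.succ_le_succ_iff.mpr q.2⟩) (by
    constructor
    · rintro (j | ⟨⟨i, j⟩, h⟩) (j' | ⟨⟨i', j'⟩, h'⟩) hq
      · simpa using hq
      · simp [Fin.ext_iff] at hq
      · simp [Fin.ext_iff] at hq
      · simpa using hq
    · rintro ⟨⟨i, j⟩, h⟩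
      have h' : i ≤ j := h
      induction i using Fin.cases with
      | zero => exact ⟨Sum.inl j, rfl⟩
      | succ i =>
        induction j using Fin.cases with
        | zero => simp at h'
        | succ j => exact ⟨Sum.inr ⟨(i, j), Fin.succ_le_succ_iff.mp h'⟩, rfl⟩)

/-- Tonelli for the splitting of a symmetric matrix into its corner x, the rest b of its first row
and the remaining block c. -/
theorem lintegral_upperIdx_succ {F : (UpperIdx (m + 1) → ℝ) → ENNReal} (hF : Measurable F) :
    ∫⁻ ξ, F ξ = ∫⁻ x : ℝ, ∫⁻ b : Fin m → ℝ, ∫⁻ c : UpperIdx m → ℝ,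
      F (nu (bordered x b b (symMat c))) := by
  have e1 := volume_measurePreserving_piCongrLeft (fun _ : UpperIdx (m + 1) => ℝ)
    (upperIdxSuccEquiv m)
  have e2 := volume_measurePreserving_sumPiEquivProdPi_symm
    (fun _ : Fin (m + 1) ⊕ UpperIdx m => ℝ)
  have e3 := (volume_preserving_piFinSuccAbove (fun _ : Fin (m + 1) => ℝ) 0).symm
  have e12 := e1.comp e2
  have hFm : Measurable fun p => F ((MeasurableEquiv.piCongrLeft (fun _ => ℝ) (upperIdxSuccEquiv m))
      ((MeasurableEquiv.sumPiEquivProdPi fun _ => ℝ).symm p)) := hF.comp e12.measurable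
  rw [← e12.lintegral_comp hF, Measure.volume_eq_prod]
  simp only [Function.comp_apply]
  rw [lintegral_prod _ hFm.aemeasurable]
  have hFm' := Measurable.lintegral_prod_right' (ν := (volume : Measure (UpperIdx m → ℝ))) hFm
  rw [← e3.lintegral_comp hFm', Measure.volume_eq_prod]
  refine (lintegral_prod _ (hFm'.comp e3.measurable).aemeasurable).trans ?_
  refine lintegral_congr fun x => lintegral_congr fun b => lintegral_congr fun c => congrArg F ?_
  ext q
  obtain ⟨s, rfl⟩ := (upperIdxSuccEquiv m).surjective q
  rw [MeasurableEquiv.coe_piCongrLeft, Equiv.piCongrLeft_apply_apply]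
  rcases s with j | ⟨⟨i, j⟩, h⟩
  · induction j using Fin.cases with
    | zero => rfl
    | succ j => rfl
  · have h' : i ≤ j := h
    change c ⟨(i, j), h⟩ = symMat c i j
    rw [symMat_apply, upperIdx_of_le h']

theorem lintegral_ofReal_exp_neg_sum_sq {x : ℝ} (hx : 0 < x) :
    ∫⁻ b : Fin m → ℝ, ENNReal.ofReal (∏ i, Real.exp (-(1 / x) * b i ^ 2)) =
      ENNReal.ofReal ((Real.pi * x) ^ ((m : ℝ) / 2)) := by
  have hi : Integrable fun y : ℝ => Real.exp (-(1 / x) * y ^ 2) :=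
    integrable_exp_neg_mul_sq (by positivity)
  rw [← ofReal_integral_eq_lintegral_ofReal]
  · rw [integral_fintype_prod_volume_eq_pow (fun y : ℝ => Real.exp (-(1 / x) * y ^ 2)),
      integral_gaussian, Fintype.card_fin, Real.sqrt_eq_rpow, ← Real.rpow_natCast,
      ← Real.rpow_mul (by positivity)]
    congr 2
    · field_simp
    · ring
  · exact Integrable.fintype_prod fun _ => hi
  · exact Filter.Eventually.of_forall fun b => Finset.prod_nonneg fun i _ => (Real.exp_pos _).le

theorem lintegral_ofReal_rpow_mul_exp_neg {a : ℝ} (ha : 0 < a) :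
    ∫⁻ x in Set.Ioi (0 : ℝ), ENNReal.ofReal (x ^ (a - 1) * Real.exp (-x)) =
      ENNReal.ofReal (Real.Gamma a) := by
  rw [Real.Gamma_eq_integral ha, ofReal_integral_eq_lintegral_ofReal]
  · simp only [mul_comm]
  · exact Real.GammaIntegral_convergent ha
  · refine (ae_restrict_iff' measurableSet_Ioi).mpr (Filter.Eventually.of_forall fun x hx => ?_)
    have : 0 < x := hx
    positivity

theorem multivariateGamma_succ (m : ℕ) (a : ℝ) :
    multivariateGamma (m + 1) a =
      Real.pi ^ ((m : ℝ) / 2) * Real.Gamma a * multivariateGamma m (a - 1 / 2) := by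
  have h : ∀ (k : ℕ) (f : ℕ → ℝ), ∏ j ∈ Finset.Icc 1 k, f j = ∏ j ∈ Finset.range k, f (j + 1) := by
    intro k f
    rw [Finset.range_eq_Ico, Finset.prod_Ico_add' f 0 k 1]
    rfl
  rw [multivariateGamma, multivariateGamma, h, h, Finset.prod_range_succ']
  have h2 : Real.pi ^ (((m + 1 : ℕ) : ℝ) * (((m + 1 : ℕ) : ℝ) - 1) / 4)
      = Real.pi ^ ((m : ℝ) / 2) * Real.pi ^ ((m : ℝ) * ((m : ℝ) - 1) / 4) := by
    rw [← Real.rpow_add Real.pi_pos]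
    congr 1
    push_cast
    ring
  have h3 : ∀ j : ℕ, a + (1 - ((j + 1 + 1 : ℕ) : ℝ)) / 2
      = a - 1 / 2 + (1 - ((j + 1 : ℕ) : ℝ)) / 2 := by
    intro j; push_cast; ring
  simp only [h2, h3]
  norm_num
  ring

theorem multivariateGamma_pos {a : ℝ} (ha : ((m : ℝ) - 1) / 2 < a) : 0 < multivariateGamma m a := by
  refine mul_pos (Real.rpow_pos_of_pos Real.pi_pos _) (Finset.prod_pos fun j hj => ?_)
  apply Real.Gamma_pos_of_pos
  have : (j : ℝ) ≤ m := by exact_mod_cast (Finset.mem_Icc.mp hj).2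
  linarith

/-- The integrand of the multivariate gamma integral. -/
def gammaIntegrand (m : ℕ) (a : ℝ) (x : UpperIdx m → ℝ) : ENNReal :=
  (posDefCoords m).indicator (fun x => ENNReal.ofReal
    ((symMat x).det ^ (a - ((m : ℝ) + 1) / 2) * Real.exp (-(symMat x).trace))) x

theorem measurable_gammaIntegrand (a : ℝ) : Measurable (gammaIntegrand m a) := by
  refine Measurable.indicator ?_ measurableSet_posDefCoords
  exact ((measurable_det_symMat.pow_const _).mul
    (Real.measurable_exp.comp (continuous_symMat.matrix_trace.neg).measurable)).ennreal_ofReal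

theorem symMat_nu_bordered (x : ℝ) (b : Fin m → ℝ) (c : UpperIdx m → ℝ) :
    symMat (nu (bordered x b b (symMat c))) = bordered x b b (symMat c) := by
  apply symMat_nu
  rw [Matrix.IsSymm, bordered_transpose, (symMat_isSymm c).eq]

/-- Shifting the block by bbᵀ/x makes c the Schur complement. Then det = x · det c and tr = x +
|b|²/x + tr c, so the integrand separates into a function of x, a Gaussian in b and the integrand of
size m. Rewriting the determinant exponent for size m lowers a by 1/2. -/
theorem gammaIntegrand_bordered {a x : ℝ} (hx : 0 < x) (b : Fin m → ℝ) (c : UpperIdx m → ℝ) :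
    gammaIntegrand (m + 1) a
        (nu (bordered x b b (symMat (c + nu (x⁻¹ • vecMulVec b b))))) =
      ENNReal.ofReal (x ^ (a - 1 - (m : ℝ) / 2) * Real.exp (-x)) *
        (ENNReal.ofReal (∏ i, Real.exp (-(1 / x) * b i ^ 2)) * gammaIntegrand m (a - 1 / 2) c) := by
  set A := bordered x b b (symMat (c + nu (x⁻¹ • vecMulVec b b))) with hA
  have hsv : symMat (c + nu (x⁻¹ • vecMulVec b b)) = symMat c + x⁻¹ • vecMulVec b b := by
    rw [show symMat (c + nu (x⁻¹ • vecMulVec b b)) = symMat c + symMat (nu (x⁻¹ • vecMulVec b b))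
      from rfl, symMat_nu]
    ext i j
    simp [vecMulVec_apply, mul_comm]
  have hsym : A.IsSymm := by
    rw [Matrix.IsSymm, hA, bordered_transpose, (symMat_isSymm _).eq]
  have hA0 : A 0 0 = x := rfl
  have hschur : schur A = symMat c := by
    ext i j
    simp only [schur, of_apply, hA, hsv, bordered_succ_succ, bordered_succ_zero,
      bordered_zero_succ, bordered_zero_zero, Matrix.add_apply, Matrix.smul_apply, vecMulVec_apply,
      smul_eq_mul]
    field_simp
    ring
  have hpos : nu A ∈ posDefCoords (m + 1) ↔ c ∈ posDefCoords m := by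
    simp only [posDefCoords, Set.mem_ofPred_eq]
    rw [symMat_nu hsym, posDef_iff_schur hsym, hschur, hA0]
    simp [hx]
  by_cases hc : c ∈ posDefCoords m
  · rw [gammaIntegrand, gammaIntegrand, Set.indicator_of_mem hc, Set.indicator_of_mem (hpos.mpr hc),
      symMat_nu hsym, det_eq_mul_det_schur hsym (by rw [hA0]; exact hx.ne'), hschur, hA0,
      ← ENNReal.ofReal_mul (Finset.prod_nonneg fun i _ => (Real.exp_pos _).le),
      ← ENNReal.ofReal_mul (by positivity)]
    have hdet : 0 < (symMat c).det := PosDef.det_pos hc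
    have htr : A.trace = x + ((symMat c).trace + x⁻¹ * ∑ i, b i ^ 2) := by
      rw [hA, trace_bordered, hsv, trace_add, trace_smul, trace_vecMulVec, smul_eq_mul, dotProduct]
      simp only [pow_two]
    have hprod : ∏ i, Real.exp (-(1 / x) * b i ^ 2) = Real.exp (-(x⁻¹ * ∑ i, b i ^ 2)) := by
      rw [← Real.exp_sum, ← Finset.mul_sum]
      congr 1
      ring
    rw [htr, hprod, Real.mul_rpow hx.le hdet.le]
    congr 1
    rw [show -(x + ((symMat c).trace + x⁻¹ * ∑ i, b i ^ 2))
      = -x + (-(x⁻¹ * ∑ i, b i ^ 2) + -(symMat c).trace) by ring, Real.exp_add, Real.exp_add,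
      show a - (((m + 1 : ℕ) : ℝ) + 1) / 2 = a - 1 - (m : ℝ) / 2 by push_cast; ring,
      show a - 1 / 2 - ((m : ℝ) + 1) / 2 = a - 1 - (m : ℝ) / 2 by ring]
    ring
  · rw [gammaIntegrand, gammaIntegrand, Set.indicator_of_notMem hc,
      Set.indicator_of_notMem (fun h => hc (hpos.mp h))]
    simp

theorem gammaIntegrand_of_nonpos {a x : ℝ} (hx : x ≤ 0) (b : Fin m → ℝ) (c : UpperIdx m → ℝ) :
    gammaIntegrand (m + 1) a (nu (bordered x b b (symMat c))) = 0 := by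
  refine Set.indicator_of_notMem (fun h => ?_) _
  have h' : (symMat (nu (bordered x b b (symMat c)))).PosDef := h
  rw [symMat_nu_bordered] at h'
  have := h'.diag_pos (i := 0)
  rw [bordered_zero_zero] at this
  linarith

theorem lintegral_gammaIntegrand {a : ℝ} (ha : ((m : ℝ) - 1) / 2 < a) :
    ∫⁻ x, gammaIntegrand m a x = ENNReal.ofReal (multivariateGamma m a) := by
  induction m generalizing a with
  | zero =>
    have : ∀ x : UpperIdx 0 → ℝ, gammaIntegrand 0 a x = 1 := by
      intro x
      have : x ∈ posDefCoords 0 := by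
        rw [posDefCoords, Set.mem_ofPred_eq, posDef_iff_dotProduct_mulVec]
        exact ⟨isHermitian_symMat x, fun y hy => absurd (Subsingleton.elim y 0) hy⟩
      simp [gammaIntegrand, this]
    have : IsEmpty (UpperIdx 0) := ⟨fun q => q.1.1.elim0⟩
    have hv : (volume : Measure (UpperIdx 0 → ℝ)) Set.univ = 1 := by
      rw [volume_pi, Measure.pi_of_empty]
      simp
    simp [*, multivariateGamma]
  | succ m ih =>
    rw [lintegral_upperIdx_succ (measurable_gammaIntegrand a)]
    have ha' : ((m : ℝ) - 1) / 2 < a - 1 / 2 := by push_cast at ha; linarith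
    have ha0 : 0 < a := by
      have : (0 : ℝ) ≤ m := Nat.cast_nonneg m
      linarith
    have h1 : ∀ x : ℝ, ∫⁻ b : Fin m → ℝ, ∫⁻ c : UpperIdx m → ℝ,
        gammaIntegrand (m + 1) a (nu (bordered x b b (symMat c))) =
        (Set.Ioi (0 : ℝ)).indicator (fun x => ENNReal.ofReal (Real.pi ^ ((m : ℝ) / 2)) *
          ENNReal.ofReal (multivariateGamma m (a - 1 / 2)) *
          ENNReal.ofReal (x ^ (a - 1) * Real.exp (-x))) x := by
      intro x
      by_cases hx : 0 < x
      · rw [Set.indicator_of_mem (show x ∈ Set.Ioi 0 from hx)]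
        have h2 : ∀ b : Fin m → ℝ, ∫⁻ c : UpperIdx m → ℝ,
            gammaIntegrand (m + 1) a (nu (bordered x b b (symMat c))) =
            ENNReal.ofReal (x ^ (a - 1 - (m : ℝ) / 2) * Real.exp (-x)) *
            (ENNReal.ofReal (∏ i, Real.exp (-(1 / x) * b i ^ 2)) *
              ENNReal.ofReal (multivariateGamma m (a - 1 / 2))) := by
          intro b
          -- Translation invariance in the block replaces c by the Schur complement plus bbᵀ/x.
          rw [← lintegral_add_right_eq_self _ (nu (x⁻¹ • vecMulVec b b))]
          simp only [gammaIntegrand_bordered hx]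
          rw [lintegral_const_mul' _ _ ENNReal.ofReal_ne_top,
            lintegral_const_mul' _ _ ENNReal.ofReal_ne_top, ih ha']
        simp only [h2]
        rw [lintegral_const_mul' _ _ ENNReal.ofReal_ne_top,
          lintegral_mul_const' _ _ ENNReal.ofReal_ne_top, lintegral_ofReal_exp_neg_sum_sq hx,
          Real.mul_rpow Real.pi_pos.le hx.le,
          ← ENNReal.ofReal_mul (by positivity), ← ENNReal.ofReal_mul (by positivity),
          ← ENNReal.ofReal_mul (by positivity),
          ← ENNReal.ofReal_mul (mul_nonneg (by positivity) (multivariateGamma_pos ha').le)]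
        congr 1
        -- The Gaussian integral contributes x^(m/2), which raises the exponent a - 1 - m/2 to that
        -- of Γ(a).
        rw [show a - 1 = (a - 1 - (m : ℝ) / 2) + (m : ℝ) / 2 by ring,
          Real.rpow_add hx (a - 1 - (m : ℝ) / 2), show a - 1 - (m : ℝ) / 2 + (m : ℝ) / 2
            - (m : ℝ) / 2 = a - 1 - (m : ℝ) / 2 by ring]
        ring
      · rw [Set.indicator_of_notMem (show x ∉ Set.Ioi 0 from hx)]
        simp [gammaIntegrand_of_nonpos (not_lt.mp hx)]
    simp only [h1]
    rw [lintegral_indicator measurableSet_Ioi,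
      lintegral_const_mul' _ _ (ENNReal.mul_ne_top ENNReal.ofReal_ne_top ENNReal.ofReal_ne_top),
      lintegral_ofReal_rpow_mul_exp_neg ha0, multivariateGamma_succ,
      ← ENNReal.ofReal_mul (by positivity),
      ← ENNReal.ofReal_mul (mul_nonneg (by positivity) (multivariateGamma_pos ha').le)]
    congr 1
    ring

/-! ### Inverse square roots -/

theorem posDef_orthogonal_conj {U : Matrix (Fin m) (Fin m) ℝ} (hU : U * Uᵀ = 1)
    {d : Fin m → ℝ} (hd : ∀ k, 0 < d k) : (U * diagonal d * Uᵀ).PosDef := by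
  have h : IsUnit U := (isUnit_iff_isUnit_det U).mpr (isUnit_det_of_right_inverse hU)
  rw [← conjTranspose_eq_transpose_of_trivial]
  exact (Matrix.IsUnit.posDef_star_right_conjugate_iff h).mpr (posDef_diagonal_iff.mpr hd)

theorem posDef_invSqrt {A : Matrix (Fin m) (Fin m) ℝ} (hA : A.PosDef) : (invSqrt A).PosDef := by
  obtain ⟨U, h1, h2, h3, h4⟩ := cfc_eq_mul_diagonal_mul hA.1
  rw [invSqrt, h4]
  exact posDef_orthogonal_conj h1 fun k => Real.rpow_pos_of_pos (hA.eigenvalues_pos k) _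

theorem invSqrt_mul_mul {A : Matrix (Fin m) (Fin m) ℝ} (hA : A.PosDef) :
    invSqrt A * A * invSqrt A = 1 := by
  obtain ⟨U, h1, h2, h3, h4⟩ := cfc_eq_mul_diagonal_mul hA.1
  have e : ∀ M, Uᵀ * (U * M) = M := fun M => by rw [← Matrix.mul_assoc, h2, Matrix.one_mul]
  have e' : invSqrt A * A * invSqrt A =
      invSqrt A * (U * diagonal hA.1.eigenvalues * Uᵀ) * invSqrt A := by rw [← h3]
  rw [e', invSqrt, h4]
  simp only [Matrix.mul_assoc, e]
  rw [← Matrix.mul_assoc (diagonal _) (diagonal _) Uᵀ, diagonal_mul_diagonal,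
    ← Matrix.mul_assoc (diagonal _) (diagonal _) Uᵀ, diagonal_mul_diagonal]
  have : (fun i => hA.1.eigenvalues i ^ (-(1 / 2) : ℝ) *
      (hA.1.eigenvalues i * hA.1.eigenvalues i ^ (-(1 / 2) : ℝ))) = fun _ => 1 := by
    ext k
    have hk := hA.eigenvalues_pos k
    rw [mul_left_comm, ← Real.rpow_add hk]
    norm_num
    rw [Real.rpow_neg_one, mul_inv_cancel₀ hk.ne']
  rw [this, diagonal_one, Matrix.one_mul, h1]

/-! ### Linear changes of variables and the Laplace transform -/

theorem mem_posDefCoords_congrCoords {R : Matrix (Fin m) (Fin m) ℝ} (hR : IsUnit R)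
    {x : UpperIdx m → ℝ} : congrCoords R x ∈ posDefCoords m ↔ x ∈ posDefCoords m := by
  simp only [posDefCoords, Set.mem_ofPred_eq, symMat_congrCoords]
  rw [← conjTranspose_eq_transpose_of_trivial]
  exact Matrix.IsUnit.posDef_star_right_conjugate_iff hR

theorem image_congrCoords {R : Matrix (Fin m) (Fin m) ℝ} (hR : IsUnit R) :
    congrCoords R '' posDefCoords m = posDefCoords m := by
  have hd := (isUnit_iff_isUnit_det R).mp hR
  ext x
  constructor
  · rintro ⟨y, hy, rfl⟩
    exact (mem_posDefCoords_congrCoords hR).mpr hy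
  · intro hx
    have h : congrCoords R (congrCoords R⁻¹ x) = x := by
      rw [← LinearMap.comp_apply, ← congrCoords_mul, mul_nonsing_inv _ hd, congrCoords_one]
      rfl
    refine ⟨congrCoords R⁻¹ x, ?_, h⟩
    rwa [← mem_posDefCoords_congrCoords hR, h]

theorem injective_congrCoords {R : Matrix (Fin m) (Fin m) ℝ} (hR : IsUnit R) :
    Function.Injective (congrCoords R) := by
  have hd := (isUnit_iff_isUnit_det R).mp hR
  refine Function.LeftInverse.injective (g := congrCoords R⁻¹) fun x => ?_
  rw [← LinearMap.comp_apply, ← congrCoords_mul, nonsing_inv_mul _ hd, congrCoords_one]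
  rfl

theorem lintegral_posDefVolume_congr {R : Matrix (Fin m) (Fin m) ℝ} (hR : R.PosDef)
    (g : (UpperIdx m → ℝ) → ENNReal) :
    ∫⁻ x, g x ∂posDefVolume m =
      ∫⁻ x, ENNReal.ofReal (R.det ^ (m + 1)) * g (congrCoords R x) ∂posDefVolume m := by
  have h := lintegral_image_eq_lintegral_abs_det_fderiv_mul volume
    (measurableSet_posDefCoords (m := m))
    (f' := fun _ => LinearMap.toContinuousLinearMap (congrCoords R))
    (fun x _ => (LinearMap.toContinuousLinearMap (congrCoords R)).hasFDerivWithinAt)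
    (injective_congrCoords hR.isUnit).injOn g
  rw [LinearMap.coe_toContinuousLinearMap', image_congrCoords hR.isUnit] at h
  rw [posDefVolume, h]
  simp only [LinearMap.det_toContinuousLinearMap, det_congrCoords hR.1,
    abs_of_pos (pow_pos hR.det_pos (m + 1))]

/-- The Laplace transform of a power of the determinant. -/
theorem lintegral_det_rpow_mul_exp {θ : Matrix (Fin m) (Fin m) ℝ} (hθ : θ.PosDef) {a : ℝ}
    (ha : ((m : ℝ) - 1) / 2 < a) :
    ∫⁻ x, ENNReal.ofReal ((symMat x).det ^ (a - ((m : ℝ) + 1) / 2) *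
        Real.exp (-(θ * symMat x).trace)) ∂posDefVolume m =
      ENNReal.ofReal (multivariateGamma m a * θ.det ^ (-a)) := by
  have hR := posDef_invSqrt hθ
  have hRθ := invSqrt_mul_mul hθ
  set R := invSqrt θ
  have hRs : Rᵀ = R := hR.1
  have hRd := hR.det_pos
  have hdet : R.det ^ 2 * θ.det = 1 := by
    have := congrArg det hRθ
    rw [det_mul, det_mul, det_one] at this
    linear_combination this
  rw [lintegral_posDefVolume_congr hR, posDefVolume]
  have h1 : ∀ x ∈ posDefCoords m, ENNReal.ofReal (R.det ^ (m + 1)) *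
      ENNReal.ofReal ((symMat (congrCoords R x)).det ^ (a - ((m : ℝ) + 1) / 2) *
        Real.exp (-(θ * symMat (congrCoords R x)).trace)) =
      ENNReal.ofReal (θ.det ^ (-a)) * gammaIntegrand m a x := by
    intro x hx
    have hxd : 0 < (symMat x).det := PosDef.det_pos hx
    have htr : (θ * (R * symMat x * R)).trace = (symMat x).trace := by
      rw [← Matrix.mul_assoc, trace_mul_comm, ← Matrix.mul_assoc, ← Matrix.mul_assoc, hRθ,
        Matrix.one_mul]
    -- With R = θ^(-1/2), the Jacobian (det R)^(m+1) compensates the shift (m + 1)/2 in the exponent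
    -- and leaves (det R)^(2a).
    have hpow : R.det ^ (m + 1) * (R.det ^ 2) ^ (a - ((m : ℝ) + 1) / 2) = θ.det ^ (-a) := by
      have : θ.det = (R.det ^ 2)⁻¹ := by
        rw [eq_inv_of_mul_eq_one_right hdet]
      rw [this, Real.inv_rpow (by positivity), Real.rpow_neg (by positivity), inv_inv]
      have : R.det ^ (m + 1) = (R.det ^ 2) ^ (((m : ℝ) + 1) / 2) := by
        rw [← Real.rpow_natCast, ← Real.rpow_natCast, ← Real.rpow_mul hRd.le]
        congr 1
        push_cast
        ring
      rw [this, ← Real.rpow_add (by positivity)]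
      congr 1
      ring
    rw [gammaIntegrand, Set.indicator_of_mem hx, symMat_congrCoords, hRs, htr, det_mul, det_mul,
      show R.det * (symMat x).det * R.det = R.det ^ 2 * (symMat x).det by ring,
      Real.mul_rpow (by positivity) hxd.le, ← ENNReal.ofReal_mul (by positivity),
      ← ENNReal.ofReal_mul (Real.rpow_nonneg hθ.det_pos.le _), ← hpow]
    congr 1
    ring
  rw [setLIntegral_congr_fun measurableSet_posDefCoords h1,
    lintegral_const_mul' _ _ ENNReal.ofReal_ne_top]
  have h2 : ∫⁻ x in posDefCoords m, gammaIntegrand m a x = ∫⁻ x, gammaIntegrand m a x := by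
    rw [← lintegral_indicator measurableSet_posDefCoords]
    congr 1
    ext1 x
    by_cases hx : x ∈ posDefCoords m <;> simp [gammaIntegrand, hx]
  rw [h2, lintegral_gammaIntegrand ha, mul_comm,
    ← ENNReal.ofReal_mul (multivariateGamma_pos ha).le]

end

section

variable {m : ℕ}

/-! ### The Wishart and inverse Wishart laws -/

theorem invCoords_mem {x : UpperIdx m → ℝ} (hx : x ∈ posDefCoords m) :
    invCoords x ∈ posDefCoords m := by
  have h : (symMat x).PosDef := hx
  rw [posDefCoords, Set.mem_ofPred_eq, symMat_invCoords]
  exact h.inv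

theorem invCoords_invCoords {x : UpperIdx m → ℝ} (hx : x ∈ posDefCoords m) :
    invCoords (invCoords x) = x := by
  have h : IsUnit (symMat x) := PosDef.isUnit hx
  rw [invCoords, symMat_invCoords, nonsing_inv_nonsing_inv _ ((isUnit_iff_isUnit_det _).mp h),
    nu_symMat]

/-- Change of variables for the involution X ↦ X⁻¹ of the cone; the sign in its differential
disappears in the absolute value. -/
theorem lintegral_posDefVolume_inv (g : (UpperIdx m → ℝ) → ENNReal) :
    ∫⁻ x, g x ∂posDefVolume m =
      ∫⁻ x, ENNReal.ofReal ((symMat x).det⁻¹ ^ (m + 1)) * g (invCoords x) ∂posDefVolume m := by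
  have himg : invCoords '' posDefCoords m = posDefCoords m := by
    ext x
    constructor
    · rintro ⟨y, hy, rfl⟩
      exact invCoords_mem hy
    · exact fun hx => ⟨invCoords x, invCoords_mem hx, invCoords_invCoords hx⟩
  have h := lintegral_image_eq_lintegral_abs_det_fderiv_mul volume
    (measurableSet_posDefCoords (m := m)) (f := invCoords)
    (f' := fun x => -LinearMap.toContinuousLinearMap (congrCoords (symMat x)⁻¹))
    (fun x hx => (hasFDerivAt_invCoords hx).hasFDerivWithinAt)
    (Set.LeftInvOn.injOn (f₁' := invCoords) fun x hx => invCoords_invCoords hx) g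
  rw [himg] at h
  rw [posDefVolume, h]
  refine setLIntegral_congr_fun measurableSet_posDefCoords fun x hx => ?_
  have hp : (symMat x).PosDef := hx
  have hdet : |(-LinearMap.toContinuousLinearMap (congrCoords (symMat x)⁻¹)).det|
      = (symMat x).det⁻¹ ^ (m + 1) := by
    rw [ContinuousLinearMap.det, ContinuousLinearMap.toLinearMap_neg, ← neg_one_smul ℝ,
      LinearMap.det_smul, abs_mul, abs_neg_one_pow, one_mul, LinearMap.coe_toContinuousLinearMap,
      det_congrCoords hp.inv.1, det_nonsing_inv, Ring.inverse_eq_inv']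
    exact abs_of_pos (pow_pos (inv_pos.mpr hp.det_pos) _)
  simp only [hdet]

theorem measurable_trace_mul_symMat (K : Matrix (Fin m) (Fin m) ℝ) :
    Measurable fun x : UpperIdx m → ℝ => (K * symMat x).trace :=
  ((continuous_const.matrix_mul continuous_symMat).matrix_trace).measurable

theorem measurable_wishartModel (n : ℕ) (ξ : UpperIdx m → ℝ) :
    Measurable (wishartModel m n ξ) :=
  ((measurable_det_symMat.pow_const _).mul
    (Real.measurable_exp.comp ((measurable_trace_mul_symMat _).const_mul _))).div_const _

theorem measurable_invWishartModel (n : ℕ) (ξ : UpperIdx m → ℝ) :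
    Measurable (invWishartModel m n ξ) := by
  have h : Measurable fun x : UpperIdx m → ℝ => (symMat ξ * (symMat x)⁻¹).trace := by
    simp only [← symMat_invCoords]
    exact (measurable_trace_mul_symMat (symMat ξ)).comp measurable_invCoords
  exact (((measurable_det_symMat.pow_const _).const_mul _).mul
    (Real.measurable_exp.comp (h.const_mul _))).div_const _

theorem sub_one_div_two_lt {n : ℕ} (hmn : m ≤ n) : ((m : ℝ) - 1) / 2 < (n : ℝ) / 2 := by
  have : (m : ℝ) ≤ n := by exact_mod_cast hmn
  linarith

theorem isSymm_of_posDef {S : Matrix (Fin m) (Fin m) ℝ} (hS : S.PosDef) : S.IsSymm := hS.1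

theorem wishartModel_nu {n : ℕ} {S : Matrix (Fin m) (Fin m) ℝ} (hS : S.PosDef)
    (x : UpperIdx m → ℝ) : wishartModel m n (nu S) x = wishartPDF n S (symMat x) := by
  rw [wishartModel, symMat_nu (isSymm_of_posDef hS)]

theorem invWishartModel_nu {n : ℕ} {S : Matrix (Fin m) (Fin m) ℝ} (hS : S.PosDef)
    (x : UpperIdx m → ℝ) : invWishartModel m n (nu S) x = invWishartPDF n S (symMat x) := by
  rw [invWishartModel, symMat_nu (isSymm_of_posDef hS)]

theorem wishartPDF_pos {n : ℕ} (hmn : m ≤ n) {S X : Matrix (Fin m) (Fin m) ℝ} (hS : S.PosDef)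
    (hX : X.PosDef) : 0 < wishartPDF n S X := by
  have h1 := hS.det_pos
  have h2 := hX.det_pos
  have h3 := multivariateGamma_pos (sub_one_div_two_lt hmn)
  unfold wishartPDF
  positivity

theorem invWishartPDF_pos {n : ℕ} (hmn : m ≤ n) {S X : Matrix (Fin m) (Fin m) ℝ} (hS : S.PosDef)
    (hX : X.PosDef) : 0 < invWishartPDF n S X := by
  have h1 := hS.det_pos
  have h2 := hX.det_pos
  have h3 := multivariateGamma_pos (sub_one_div_two_lt hmn)
  unfold invWishartPDF
  positivity

/-- The moment generating function of the Wishart law. -/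
theorem lintegral_wishartMeasure_exp {n : ℕ} (hmn : m ≤ n) {S K : Matrix (Fin m) (Fin m) ℝ}
    (hS : S.PosDef) (hK : ((1 / 2 : ℝ) • S⁻¹ - K).PosDef) :
    ∫⁻ x, ENNReal.ofReal (Real.exp (K * symMat x).trace) ∂wishartMeasure n S =
      ENNReal.ofReal (((1 / 2 : ℝ) • S⁻¹ - K).det ^ (-((n : ℝ) / 2)) /
        (2 ^ ((n : ℝ) * m / 2) * S.det ^ ((n : ℝ) / 2))) := by
  have hΓ := multivariateGamma_pos (sub_one_div_two_lt hmn)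
  have hSd := hS.det_pos
  have hexp : Measurable fun x : UpperIdx m → ℝ => ENNReal.ofReal (Real.exp (K * symMat x).trace) :=
    (Real.measurable_exp.comp (measurable_trace_mul_symMat K)).ennreal_ofReal
  rw [wishartMeasure, lintegral_withDensity_eq_lintegral_mul _
    (measurable_wishartModel n (nu S)).ennreal_ofReal hexp]
  -- The tilt by exp tr(KX) only replaces ½S⁻¹ by ½S⁻¹ - K, so a Laplace integral of a determinant
  -- power remains.
  have h : ∀ x, ((fun x => ENNReal.ofReal (wishartModel m n (nu S) x)) *
      fun x => ENNReal.ofReal (Real.exp (K * symMat x).trace)) x =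
      ENNReal.ofReal (2 ^ ((n : ℝ) * m / 2) * S.det ^ ((n : ℝ) / 2) *
        multivariateGamma m ((n : ℝ) / 2))⁻¹ *
      ENNReal.ofReal ((symMat x).det ^ ((n : ℝ) / 2 - ((m : ℝ) + 1) / 2) *
        Real.exp (-(((1 / 2 : ℝ) • S⁻¹ - K) * symMat x).trace)) := by
    intro x
    rw [Pi.mul_apply, mul_comm, ← ENNReal.ofReal_mul (Real.exp_pos _).le,
      ← ENNReal.ofReal_mul (by positivity), wishartModel_nu hS, wishartPDF]
    congr 1
    rw [Matrix.sub_mul, trace_sub, Matrix.smul_mul, trace_smul, smul_eq_mul,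
      show -(1 / 2 * (S⁻¹ * symMat x).trace - (K * symMat x).trace)
        = -(1 / 2) * (S⁻¹ * symMat x).trace + (K * symMat x).trace by ring, Real.exp_add,
      show (n : ℝ) / 2 - ((m : ℝ) + 1) / 2 = ((n : ℝ) - m - 1) / 2 by ring]
    field_simp
  simp only [h]
  rw [lintegral_const_mul' _ _ ENNReal.ofReal_ne_top, lintegral_det_rpow_mul_exp hK (sub_one_div_two_lt hmn),
    ← ENNReal.ofReal_mul (by positivity)]
  congr 1
  field_simp

theorem wishart_normalization (n : ℕ) {S : Matrix (Fin m) (Fin m) ℝ} (hS : S.PosDef) :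
    ((1 / 2 : ℝ) • S⁻¹).det ^ (-((n : ℝ) / 2)) =
      2 ^ ((n : ℝ) * m / 2) * S.det ^ ((n : ℝ) / 2) := by
  have hSd := hS.det_pos
  rw [det_smul, det_nonsing_inv, Ring.inverse_eq_inv', Fintype.card_fin,
    Real.mul_rpow (by positivity) (by positivity), Real.inv_rpow hSd.le, Real.rpow_neg hSd.le,
    inv_inv, ← Real.rpow_natCast, ← Real.rpow_mul (by norm_num), one_div,
    Real.inv_rpow (by norm_num), ← Real.rpow_neg (by norm_num)]
  congr 2
  ring

theorem isProbabilityMeasure_wishartMeasure {n : ℕ} (hmn : m ≤ n) {S : Matrix (Fin m) (Fin m) ℝ}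
    (hS : S.PosDef) : IsProbabilityMeasure (wishartMeasure n S) := by
  have hSd := hS.det_pos
  have h := lintegral_wishartMeasure_exp hmn hS (K := 0)
    (by rw [sub_zero]; exact hS.inv.smul (by norm_num : (0 : ℝ) < 1 / 2))
  refine ⟨?_⟩
  simp only [Matrix.zero_mul, trace_zero, Real.exp_zero, ENNReal.ofReal_one, lintegral_const,
    one_mul, sub_zero] at h
  rw [h, ← ENNReal.ofReal_one, wishart_normalization n hS]
  congr 1
  exact div_self (by positivity)

theorem map_invCoords_invWishartMeasure (n : ℕ) {S : Matrix (Fin m) (Fin m) ℝ}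
    (hS : S.PosDef) : (invWishartMeasure n S).map invCoords = wishartMeasure n S⁻¹ := by
  ext E hE
  rw [Measure.map_apply measurable_invCoords hE, invWishartMeasure, wishartMeasure,
    withDensity_apply _ (measurable_invCoords hE), withDensity_apply _ hE,
    ← lintegral_indicator (measurable_invCoords hE), ← lintegral_indicator hE,
    lintegral_posDefVolume_inv (E.indicator _)]
  refine setLIntegral_congr_fun measurableSet_posDefCoords fun x hx => ?_
  have hX : (symMat x).PosDef := hx
  have hd := hX.det_pos
  have hSd := hS.det_pos
  by_cases hxE : invCoords x ∈ E
  · rw [Set.indicator_of_mem hxE, Set.indicator_of_mem (show x ∈ invCoords ⁻¹' E from hxE),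
      ← ENNReal.ofReal_mul (by positivity), invWishartModel_nu hS, wishartModel_nu hS.inv,
      symMat_invCoords, invWishartPDF, wishartPDF,
      nonsing_inv_nonsing_inv _ ((isUnit_iff_isUnit_det _).mp hS.isUnit), det_nonsing_inv,
      det_nonsing_inv, Ring.inverse_eq_inv']
    congr 1
    -- The exponents of the two densities differ by the m + 1 of the Jacobian.
    rw [Real.inv_rpow hSd.le, Real.inv_rpow hd.le, ← Real.rpow_neg hd.le,
      show -((n : ℝ) + m + 1) / 2 = -(((n : ℝ) - m - 1) / 2) + -((m + 1 : ℕ) : ℝ) by push_cast; ring,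
      Real.rpow_add hd, Real.rpow_neg hd.le ((m + 1 : ℕ) : ℝ), Real.rpow_natCast, inv_pow]
    field_simp
  · rw [Set.indicator_of_notMem hxE, Set.indicator_of_notMem (show x ∉ invCoords ⁻¹' E from hxE),
      mul_zero]

theorem isProbabilityMeasure_invWishartMeasure {n : ℕ} (hmn : m ≤ n)
    {S : Matrix (Fin m) (Fin m) ℝ} (hS : S.PosDef) :
    IsProbabilityMeasure (invWishartMeasure n S) := by
  have h := isProbabilityMeasure_wishartMeasure hmn hS.inv
  rw [← map_invCoords_invWishartMeasure n hS] at h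
  exact Measure.isProbabilityMeasure_of_map invCoords

end

section

variable {m : ℕ}

/-! ### Second moments of the Wishart law -/

theorem inv_invSqrt_mul_self {S : Matrix (Fin m) (Fin m) ℝ} (hS : S.PosDef) :
    (invSqrt S)⁻¹ * (invSqrt S)⁻¹ = S := by
  have hu := (isUnit_iff_isUnit_det _).mp (posDef_invSqrt hS).isUnit
  have h := invSqrt_mul_mul hS
  calc (invSqrt S)⁻¹ * (invSqrt S)⁻¹
      = (invSqrt S)⁻¹ * (invSqrt S * S * invSqrt S) * (invSqrt S)⁻¹ := by rw [h, Matrix.mul_one]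
    _ = S := by
      rw [Matrix.mul_assoc (invSqrt S), ← Matrix.mul_assoc, nonsing_inv_mul _ hu, Matrix.one_mul,
        Matrix.mul_assoc, mul_nonsing_inv _ hu, Matrix.mul_one]

/-- Simultaneous diagonalization of a positive definite and a symmetric matrix. -/
theorem exists_simultaneous_diagonal {S H : Matrix (Fin m) (Fin m) ℝ} (hS : S.PosDef)
    (hH : H.IsSymm) : ∃ (B : Matrix (Fin m) (Fin m) ℝ) (c : Fin m → ℝ),
      IsUnit B ∧ S = B * Bᵀ ∧ Bᵀ * H * B = diagonal c := by
  -- R is the positive square root of S, and B will be RU with U orthogonal and diagonalizing RHR.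
  set R := (invSqrt S)⁻¹ with hR
  have hRp : R.PosDef := (posDef_invSqrt hS).inv
  have hRs : Rᵀ = R := hRp.1
  have hRR : R * R = S := inv_invSqrt_mul_self hS
  have hC : (R * H * R).IsHermitian := by
    rw [IsHermitian, conjTranspose_eq_transpose_of_trivial, transpose_mul, transpose_mul, hRs,
      hH.eq, Matrix.mul_assoc]
  obtain ⟨U, h1, h2, h3, -⟩ := cfc_eq_mul_diagonal_mul hC
  have hU : IsUnit U := (isUnit_iff_isUnit_det U).mpr (isUnit_det_of_right_inverse h1)
  refine ⟨R * U, hC.eigenvalues, hRp.isUnit.mul hU, ?_, ?_⟩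
  · rw [transpose_mul, hRs, Matrix.mul_assoc, ← Matrix.mul_assoc U, h1, Matrix.one_mul, hRR]
  · calc (R * U)ᵀ * H * (R * U) = Uᵀ * (R * H * R) * U := by
          rw [transpose_mul, hRs]; simp only [Matrix.mul_assoc]
      _ = Uᵀ * (U * diagonal hC.eigenvalues * Uᵀ) * U := congrArg (fun M => Uᵀ * M * U) h3
      _ = diagonal hC.eigenvalues := by
          rw [Matrix.mul_assoc U, ← Matrix.mul_assoc Uᵀ, h2, Matrix.one_mul, Matrix.mul_assoc, h2,
            Matrix.mul_one]

variable {n : ℕ} {S H B : Matrix (Fin m) (Fin m) ℝ} {c : Fin m → ℝ}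

theorem half_smul_inv_sub_eq (hB : IsUnit B) (hS : S = B * Bᵀ)
    (hc : Bᵀ * H * B = diagonal c) (t : ℝ) :
    (1 / 2 : ℝ) • S⁻¹ - t • H = B⁻¹ᵀ * diagonal (fun k => 1 / 2 * (1 - 2 * t * c k)) * B⁻¹ := by
  have hd := (isUnit_iff_isUnit_det B).mp hB
  have hd' : IsUnit Bᵀ.det := by rwa [det_transpose]
  have h1 : H = B⁻¹ᵀ * diagonal c * B⁻¹ := by
    rw [← hc, transpose_nonsing_inv]
    simp only [Matrix.mul_assoc]
    rw [mul_nonsing_inv _ hd, Matrix.mul_one, ← Matrix.mul_assoc, nonsing_inv_mul _ hd',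
      Matrix.one_mul]
  have h2 : S⁻¹ = B⁻¹ᵀ * B⁻¹ := by rw [hS, Matrix.mul_inv_rev, transpose_nonsing_inv]
  have h3 : diagonal (fun k => 1 / 2 * (1 - 2 * t * c k)) = (1 / 2 : ℝ) • 1 - t • diagonal c := by
    rw [← diagonal_one, ← diagonal_smul, ← diagonal_smul, diagonal_sub]
    congr 1
    ext k
    simp
    ring
  rw [h3, Matrix.mul_sub, Matrix.sub_mul, Matrix.mul_smul, Matrix.smul_mul, Matrix.mul_smul,
    Matrix.smul_mul, Matrix.mul_one, ← h2, ← h1]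

/-- Only the determinant of ½S⁻¹ - tH enters, and it is diagonalized by B. The outcome is the
transform of a sum of independent χ² variables with n degrees of freedom, weighted by the cₖ. -/
theorem lintegral_wishartMeasure_exp_smul (hmn : m ≤ n) (hS' : S.PosDef) (hB : IsUnit B)
    (hS : S = B * Bᵀ) (hc : Bᵀ * H * B = diagonal c) {t : ℝ} (ht : ∀ k, 0 < 1 - 2 * t * c k) :
    ∫⁻ x, ENNReal.ofReal (Real.exp (t * (H * symMat x).trace)) ∂wishartMeasure n S =
      ENNReal.ofReal (∏ k, (1 - 2 * t * c k) ^ (-((n : ℝ) / 2))) := by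
  have hBi : IsUnit B⁻¹ᵀ := by
    rw [isUnit_iff_isUnit_det, det_transpose, ← isUnit_iff_isUnit_det, isUnit_nonsing_inv_iff]
    exact hB
  have hpos : ((1 / 2 : ℝ) • S⁻¹ - t • H).PosDef := by
    rw [half_smul_inv_sub_eq hB hS hc]
    have := (Matrix.IsUnit.posDef_star_right_conjugate_iff hBi (x := diagonal
      (fun k => 1 / 2 * (1 - 2 * t * c k)))).mpr
      (posDef_diagonal_iff.mpr fun k => mul_pos (by norm_num) (ht k))
    rw [star_eq_conjTranspose, conjTranspose_eq_transpose_of_trivial, transpose_transpose] at this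
    exact this
  have hdet : ((1 / 2 : ℝ) • S⁻¹ - t • H).det
      = ((1 / 2 : ℝ) • S⁻¹).det * ∏ k, (1 - 2 * t * c k) := by
    have h0 := half_smul_inv_sub_eq (t := 0) hB hS hc
    simp only [zero_smul, sub_zero, mul_zero, zero_mul, mul_one] at h0
    rw [half_smul_inv_sub_eq hB hS hc, h0, det_mul, det_mul, det_mul, det_mul, det_diagonal,
      det_diagonal, Finset.prod_mul_distrib]
    ring
  have hSd := hS'.det_pos
  have h := lintegral_wishartMeasure_exp hmn hS' hpos
  simp only [Matrix.smul_mul, trace_smul, smul_eq_mul] at h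
  rw [h, hdet, Real.mul_rpow (hS'.inv.smul (by norm_num : (0 : ℝ) < 1 / 2)).det_pos.le
    (Finset.prod_nonneg fun k _ => (ht k).le), wishart_normalization n hS',
    mul_div_cancel_left₀ _ (by positivity), Real.finsetProd_rpow _ _ fun k _ => (ht k).le]

theorem eventually_one_sub_pos (c : Fin m → ℝ) : ∀ᶠ t in nhds (0 : ℝ), ∀ k, 0 < 1 - 2 * t * c k := by
  rw [Filter.eventually_all]
  intro k
  have h : ContinuousAt (fun t : ℝ => 1 - 2 * t * c k) 0 := by fun_prop
  exact h.eventually (lt_mem_nhds (by simp))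

-- The derivatives at 0 of -(n/2) ∑ log(1 - 2t cₖ) are the mean n ∑ cₖ = n tr(HS) and the variance
-- 2n ∑ cₖ² = 2n tr(HSHS).
open ProbabilityTheory in
theorem wishart_trace_variance (hmn : m ≤ n) (hS : S.PosDef) (hH : H.IsSymm) :
    MemLp (fun x => (H * symMat x).trace) 2 (wishartMeasure n S) ∧
      ∫ x, ((H * symMat x).trace - n * (H * S).trace) ^ 2 ∂wishartMeasure n S =
        2 * n * (H * S * H * S).trace := by
  obtain ⟨B, c, hB, hSB, hc⟩ := exists_simultaneous_diagonal hS hH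
  have hprob := isProbabilityMeasure_wishartMeasure hmn hS
  set μ := wishartMeasure n S
  set T : (UpperIdx m → ℝ) → ℝ := fun x => (H * symMat x).trace with hT
  have hTm : Measurable T := measurable_trace_mul_symMat H
  have hint : ∀ t : ℝ, (∀ k, 0 < 1 - 2 * t * c k) →
      Integrable (fun x => Real.exp (t * T x)) μ ∧
      mgf T μ t = ∏ k, (1 - 2 * t * c k) ^ (-((n : ℝ) / 2)) := by
    intro t ht
    have h := lintegral_wishartMeasure_exp_smul (n := n) hmn hS hB hSB hc ht
    have hm : AEStronglyMeasurable (fun x => Real.exp (t * T x)) μ :=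
      (Real.measurable_exp.comp (hTm.const_mul t)).aestronglyMeasurable
    have hnn : 0 ≤ᵐ[μ] fun x => Real.exp (t * T x) :=
      Filter.Eventually.of_forall fun x => (Real.exp_pos _).le
    refine ⟨⟨hm, ?_⟩, ?_⟩
    · rw [hasFiniteIntegral_iff_ofReal hnn, h]
      exact ENNReal.ofReal_lt_top
    · rw [mgf, integral_eq_lintegral_of_nonneg_ae hnn hm, h, ENNReal.toReal_ofReal]
      exact Finset.prod_nonneg fun k _ => Real.rpow_nonneg (ht k).le _
  -- Finite exponential moments on a neighbourhood of 0 give square integrability and allow the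
  -- cumulants to be read off.
  have hmem : (0 : ℝ) ∈ interior (integrableExpSet T μ) := by
    rw [mem_interior_iff_mem_nhds]
    filter_upwards [eventually_one_sub_pos c] with t ht
    exact (hint t ht).1
  have hcgf : cgf T μ =ᶠ[nhds 0] fun t => ∑ k, -((n : ℝ) / 2) * Real.log (1 - 2 * t * c k) := by
    filter_upwards [eventually_one_sub_pos c] with t ht
    rw [cgf, (hint t ht).2, Real.log_prod fun k _ => (Real.rpow_pos_of_pos (ht k) _).ne']
    exact Finset.sum_congr rfl fun k _ => Real.log_rpow (ht k) _
  have hd : ∀ t : ℝ, ∀ k, HasDerivAt (fun t : ℝ => 1 - 2 * t * c k) (-2 * c k) t := by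
    intro t k
    refine ((((hasDerivAt_id t).const_mul 2).mul_const (c k)).const_sub 1).congr_deriv ?_
    ring
  have hderiv : deriv (cgf T μ) =ᶠ[nhds 0] fun t => ∑ k, (n : ℝ) * c k / (1 - 2 * t * c k) := by
    refine hcgf.deriv.trans ?_
    filter_upwards [eventually_one_sub_pos c] with t ht
    refine HasDerivAt.deriv ?_
    have := HasDerivAt.fun_sum (u := Finset.univ) fun k _ =>
      (((hd t k).log (ht k).ne').const_mul (-((n : ℝ) / 2)))
    refine this.congr_deriv (Finset.sum_congr rfl fun k _ => ?_)
    ring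
  have hmean : deriv (cgf T μ) 0 = n * (H * S).trace := by
    have : (H * S).trace = ∑ k, c k := by
      rw [hSB, ← Matrix.mul_assoc, trace_mul_comm, ← Matrix.mul_assoc, hc, trace_diagonal]
    rw [hderiv.eq_of_nhds, this, Finset.mul_sum]
    simp
  have hvar : iteratedDeriv 2 (cgf T μ) 0 = 2 * n * (H * S * H * S).trace := by
    have htr : (H * S * H * S).trace = ∑ k, c k * c k := by
      have : (H * S * H * S).trace = ((Bᵀ * H * B) * (Bᵀ * H * B)).trace := by
        rw [hSB]
        conv_rhs => rw [Matrix.mul_assoc Bᵀ, Matrix.mul_assoc Bᵀ, trace_mul_comm]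
        simp only [Matrix.mul_assoc]
      rw [this, hc, diagonal_mul_diagonal, trace_diagonal]
    rw [iteratedDeriv_succ, iteratedDeriv_one, hderiv.deriv_eq, htr, Finset.mul_sum]
    refine HasDerivAt.deriv ?_
    have := HasDerivAt.fun_sum (u := Finset.univ) fun k _ =>
      ((hasDerivAt_const (0 : ℝ) ((n : ℝ) * c k)).div (hd 0 k) (by simp))
    refine this.congr_deriv (Finset.sum_congr rfl fun k _ => ?_)
    simp
    ring
  refine ⟨memLp_of_mem_interior_integrableExpSet hmem 2, ?_⟩
  have h2 := iteratedDeriv_two_cgf_eq_integral hmem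
  rw [hvar, hmean] at h2
  simpa using h2.symm

/-- The centred linear statistic `½ tr (H X) - (n/2) tr (H S)` of a Wishart matrix. -/
def centredTrace (n : ℕ) (S H : Matrix (Fin m) (Fin m) ℝ) (x : UpperIdx m → ℝ) : ℝ :=
  1 / 2 * (H * symMat x).trace - n / 2 * (H * S).trace

theorem memLp_centredTrace (hmn : m ≤ n) (hS : S.PosDef) (hH : H.IsSymm) :
    MemLp (centredTrace n S H) 2 (wishartMeasure n S) := by
  have := isProbabilityMeasure_wishartMeasure hmn hS
  exact ((wishart_trace_variance hmn hS hH).1.const_mul (1 / 2)).sub (memLp_const _)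

theorem integral_centredTrace_sq (hmn : m ≤ n) (hS : S.PosDef) (hH : H.IsSymm) :
    ∫ x, centredTrace n S H x ^ 2 ∂wishartMeasure n S = n / 2 * (H * S * H * S).trace := by
  have h : ∀ x, centredTrace n S H x ^ 2
      = 1 / 4 * ((H * symMat x).trace - n * (H * S).trace) ^ 2 := by
    intro x; rw [centredTrace]; ring
  simp only [h]
  rw [integral_const_mul, (wishart_trace_variance hmn hS hH).2]
  ring

/-- Polarization of the variance formula in H + K; the mixed traces agree by cyclicity. -/
theorem integral_centredTrace_mul (hmn : m ≤ n) (hS : S.PosDef) (hH : H.IsSymm)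
    {K : Matrix (Fin m) (Fin m) ℝ} (hK : K.IsSymm) :
    Integrable (fun x => centredTrace n S H x * centredTrace n S K x) (wishartMeasure n S) ∧
    ∫ x, centredTrace n S H x * centredTrace n S K x ∂wishartMeasure n S =
      n / 2 * (H * S * K * S).trace := by
  have hmH := memLp_centredTrace hmn hS hH
  have hmK := memLp_centredTrace hmn hS hK
  have hint : Integrable (fun x => centredTrace n S H x * centredTrace n S K x)
    (wishartMeasure n S) := hmH.integrable_mul hmK
  refine ⟨hint, ?_⟩
  have hadd := integral_centredTrace_sq hmn hS (hH.add hK)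
  have h : ∀ x, centredTrace n S (H + K) x ^ 2 = (centredTrace n S H x ^ 2
      + centredTrace n S K x ^ 2) + 2 * (centredTrace n S H x * centredTrace n S K x) := by
    intro x
    simp only [centredTrace, Matrix.add_mul, trace_add]
    ring
  have hsq : Integrable (fun x => centredTrace n S H x ^ 2 + centredTrace n S K x ^ 2)
    (wishartMeasure n S) := hmH.integrable_sq.add hmK.integrable_sq
  simp only [h] at hadd
  rw [integral_add hsq (hint.const_mul 2),
    integral_add hmH.integrable_sq hmK.integrable_sq, integral_const_mul,
    integral_centredTrace_sq hmn hS hH, integral_centredTrace_sq hmn hS hK] at hadd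
  have htr : (K * S * H * S).trace = (H * S * K * S).trace := by
    rw [Matrix.mul_assoc, trace_mul_comm, ← Matrix.mul_assoc]
  have hexp : ((H + K) * S * (H + K) * S).trace = (H * S * H * S).trace + (K * S * K * S).trace
      + 2 * (H * S * K * S).trace := by
    simp only [Matrix.add_mul, Matrix.mul_add, trace_add, htr]
    ring
  rw [hexp] at hadd
  linarith

end

section

variable {m n : ℕ}

/-! ### Scores and Fisher matrices -/

theorem duplicationMatrix_mulVec (v : UpperIdx m → ℝ) :
    duplicationMatrix m *ᵥ v = vec (symMat v) := by
  have := (eq_duplicationMatrix_iff (duplicationMatrix m)).mpr rfl _ (symMat_isSymm v)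
  rwa [nu_symMat] at this

/-- D v is the vectorization of the symmetric matrix of v, P ⊗ P acts on vectorizations as V ↦ PVPᵀ,
and their dot product is a trace. -/
theorem dotProduct_duplicationMatrix_mulVec (P : Matrix (Fin m) (Fin m) ℝ) (hP : P.IsSymm)
    (v w : UpperIdx m → ℝ) :
    v ⬝ᵥ (((duplicationMatrix m)ᵀ * (P ⊗ₖ P) * duplicationMatrix m) *ᵥ w) =
      (P * symMat v * P * symMat w).trace := by
  rw [← mulVec_mulVec, ← mulVec_mulVec, dotProduct_mulVec, vecMul_transpose,
    duplicationMatrix_mulVec, duplicationMatrix_mulVec, kronecker_mulVec_vec, vec_dotProduct_vec,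
    (symMat_isSymm v).eq, hP.eq, ← Matrix.mul_assoc, trace_mul_comm]
  simp only [Matrix.mul_assoc]

theorem hasDerivAt_line (ξ v : UpperIdx m → ℝ) : HasDerivAt (fun t : ℝ => ξ + t • v) v 0 := by
  simpa using ((hasDerivAt_id (0 : ℝ)).smul_const v).const_add ξ

theorem eventually_line_mem {ξ : UpperIdx m → ℝ} (hξ : ξ ∈ posDefCoords m) (v : UpperIdx m → ℝ) :
    ∀ᶠ t in nhds (0 : ℝ), ξ + t • v ∈ posDefCoords m := by
  refine (hasDerivAt_line ξ v).continuousAt.eventually (isOpen_posDefCoords.mem_nhds ?_)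
  simpa using hξ

theorem hasDerivAt_det_line {ξ : UpperIdx m → ℝ} (hξ : ξ ∈ posDefCoords m) (v : UpperIdx m → ℝ) :
    HasDerivAt (fun t : ℝ => Real.log (symMat (ξ + t • v)).det)
      ((symMat ξ)⁻¹ * symMat v).trace 0 := by
  have hS : (symMat ξ).PosDef := hξ
  have hu := (isUnit_iff_isUnit_det _).mp hS.isUnit
  set M := (symMat ξ)⁻¹ * symMat v with hM
  have h1 : ∀ t : ℝ, (symMat (ξ + t • v)).det = (symMat ξ).det * (1 + t • M).det := by
    intro t
    rw [← det_mul, Matrix.mul_add, Matrix.mul_one, Matrix.mul_smul, hM, ← Matrix.mul_assoc,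
      mul_nonsing_inv _ hu, Matrix.one_mul]
    rfl
  -- q(t) t² is the remainder in det(1 + tM) = 1 + t tr M + q(t) t²; it does not affect the
  -- derivative at 0.
  set q := ((1 + (Polynomial.X : Polynomial ℝ) • M.map Polynomial.C).det).divX.divX
  have h2 : HasDerivAt (fun t : ℝ => (1 + t • M).det) M.trace 0 := by
    refine HasDerivAt.congr_of_eventuallyEq ?_
      (Filter.Eventually.of_forall fun t => det_one_add_smul t M)
    refine ((((hasDerivAt_id (0 : ℝ)).const_mul M.trace).const_add 1).add
      ((q.hasDerivAt 0).mul ((hasDerivAt_id (0 : ℝ)).pow 2))).congr_deriv ?_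
    simp
  simp only [h1]
  refine ((h2.const_mul (symMat ξ).det).log ?_).congr_deriv ?_
  · simpa using hS.det_pos.ne'
  · have := hS.det_pos.ne'
    simp only [zero_smul, add_zero, det_one, mul_one]
    field_simp

theorem hasDerivAt_trace_inv_line {ξ : UpperIdx m → ℝ} (hξ : ξ ∈ posDefCoords m)
    (v : UpperIdx m → ℝ) (X : Matrix (Fin m) (Fin m) ℝ) :
    HasDerivAt (fun t : ℝ => ((symMat (ξ + t • v))⁻¹ * X).trace)
      (-((symMat ξ)⁻¹ * symMat v * (symMat ξ)⁻¹ * X).trace) 0 := by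
  let φ : (UpperIdx m → ℝ) →ₗ[ℝ] ℝ :=
    { toFun := fun y => (symMat y * X).trace
      map_add' := fun y z => by
        rw [show symMat (y + z) = symMat y + symMat z from rfl, Matrix.add_mul, trace_add]
      map_smul' := fun r y => by
        rw [show symMat (r • y) = r • symMat y from rfl, Matrix.smul_mul, trace_smul]; rfl }
  have h0 : HasFDerivAt invCoords (-LinearMap.toContinuousLinearMap (congrCoords (symMat ξ)⁻¹))
      (ξ + (0 : ℝ) • v) := by
    simpa using hasFDerivAt_invCoords hξ
  have h1 := h0.comp_hasDerivAt (0 : ℝ) (hasDerivAt_line ξ v)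
  have h2 := (LinearMap.toContinuousLinearMap φ).hasFDerivAt.comp_hasDerivAt (0 : ℝ) h1
  have h3 : ∀ t : ℝ, ((symMat (ξ + t • v))⁻¹ * X).trace = φ (invCoords (ξ + t • v)) := by
    intro t
    change _ = (symMat (invCoords (ξ + t • v)) * X).trace
    rw [symMat_invCoords]
  simp only [h3]
  refine h2.congr_deriv ?_
  rw [_root_.neg_apply, map_neg]
  change -(symMat (congrCoords (symMat ξ)⁻¹ v) * X).trace = _
  rw [symMat_congrCoords, transpose_nonsing_inv, (symMat_isSymm ξ).eq]

theorem hasDerivAt_log_wishartModel (hmn : m ≤ n) {ξ x : UpperIdx m → ℝ}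
    (hξ : ξ ∈ posDefCoords m) (hx : x ∈ posDefCoords m) (v : UpperIdx m → ℝ) :
    HasDerivAt (fun t : ℝ => Real.log (wishartModel m n (ξ + t • v) x))
      (centredTrace n (symMat ξ) ((symMat ξ)⁻¹ * symMat v * (symMat ξ)⁻¹) x) 0 := by
  have hX : (symMat x).PosDef := hx
  have hS : (symMat ξ).PosDef := hξ
  have hd := hX.det_pos
  have hΓ := multivariateGamma_pos (sub_one_div_two_lt hmn)
  have heq : (fun t : ℝ => Real.log (wishartModel m n (ξ + t • v) x)) =ᶠ[nhds 0] fun t =>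
      (((n : ℝ) - m - 1) / 2 * Real.log (symMat x).det - Real.log (2 ^ ((n : ℝ) * m / 2)) -
        Real.log (multivariateGamma m ((n : ℝ) / 2))) +
      (-(1 / 2) * ((symMat (ξ + t • v))⁻¹ * symMat x).trace -
        (n : ℝ) / 2 * Real.log (symMat (ξ + t • v)).det) := by
    filter_upwards [eventually_line_mem hξ v] with t ht
    have hd' : 0 < (symMat (ξ + t • v)).det := PosDef.det_pos ht
    rw [wishartModel, wishartPDF, Real.log_div (by positivity) (by positivity),
      Real.log_mul (by positivity) (by positivity), Real.log_mul (by positivity) (by positivity),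
      Real.log_mul (by positivity) (by positivity), Real.log_exp, Real.log_rpow hd,
      Real.log_rpow hd']
    ring
  refine HasDerivAt.congr_of_eventuallyEq ?_ heq
  refine ((((hasDerivAt_trace_inv_line hξ v (symMat x)).const_mul (-(1 / 2))).sub
    ((hasDerivAt_det_line hξ v).const_mul ((n : ℝ) / 2))).const_add _).congr_deriv ?_
  rw [centredTrace, Matrix.mul_assoc _ _ (symMat ξ),
    nonsing_inv_mul _ ((isUnit_iff_isUnit_det _).mp hS.isUnit), Matrix.mul_one]
  ring

/-- Apart from (n/2) log det Σ, the log-likelihood is affine in Σ. The score is thus a linear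
statistic of X⁻¹, centred for the parameter Σ⁻¹. -/
theorem hasDerivAt_log_invWishartModel (hmn : m ≤ n) {ξ x : UpperIdx m → ℝ}
    (hξ : ξ ∈ posDefCoords m) (hx : x ∈ posDefCoords m) (v : UpperIdx m → ℝ) :
    HasDerivAt (fun t : ℝ => Real.log (invWishartModel m n (ξ + t • v) x))
      (-centredTrace n (symMat ξ)⁻¹ (symMat v) (invCoords x)) 0 := by
  have hX : (symMat x).PosDef := hx
  have hd := hX.det_pos
  have hΓ := multivariateGamma_pos (sub_one_div_two_lt hmn)
  have heq : (fun t : ℝ => Real.log (invWishartModel m n (ξ + t • v) x)) =ᶠ[nhds 0] fun t =>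
      (-((n : ℝ) + m + 1) / 2 * Real.log (symMat x).det - Real.log (2 ^ ((n : ℝ) * m / 2)) -
        Real.log (multivariateGamma m ((n : ℝ) / 2)) - 1 / 2 * (symMat ξ * (symMat x)⁻¹).trace) +
      ((n : ℝ) / 2 * Real.log (symMat (ξ + t • v)).det -
        t * (1 / 2 * (symMat v * (symMat x)⁻¹).trace)) := by
    filter_upwards [eventually_line_mem hξ v] with t ht
    have hd' : 0 < (symMat (ξ + t • v)).det := PosDef.det_pos ht
    rw [invWishartModel, invWishartPDF, Real.log_div (by positivity) (by positivity),
      Real.log_mul (by positivity) (by positivity), Real.log_mul (by positivity) (by positivity),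
      Real.log_mul (by positivity) (by positivity), Real.log_exp, Real.log_rpow hd,
      Real.log_rpow hd', show symMat (ξ + t • v) = symMat ξ + t • symMat v from rfl,
      Matrix.add_mul, trace_add, Matrix.smul_mul, trace_smul, smul_eq_mul]
    ring
  refine HasDerivAt.congr_of_eventuallyEq ?_ heq
  refine ((((hasDerivAt_det_line hξ v).const_mul ((n : ℝ) / 2)).sub
    ((hasDerivAt_id (0 : ℝ)).mul_const _)).const_add _).congr_deriv ?_
  rw [centredTrace, symMat_invCoords, trace_mul_comm (symMat ξ)⁻¹]
  ring

/-! ### Fisher integrals as second moments of the laws. -/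

theorem integrable_mul_and_integral_withDensity {α : Type*} [MeasurableSpace α] {μ : Measure α}
    {p g F : α → ℝ} (hp : Measurable p) (hF : ∀ᵐ x ∂μ, 0 ≤ p x ∧ F x = p x * g x)
    (hg : Integrable g (μ.withDensity fun x => ENNReal.ofReal (p x))) :
    Integrable F μ ∧
      ∫ x, F x ∂μ = ∫ x, g x ∂(μ.withDensity fun x => ENNReal.ofReal (p x)) := by
  have hae : F =ᵐ[μ] fun x => (ENNReal.ofReal (p x)).toReal • g x := by
    filter_upwards [hF] with x hx
    rw [ENNReal.toReal_ofReal hx.1, hx.2, smul_eq_mul]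
  rw [integrable_withDensity_iff_integrable_smul' hp.ennreal_ofReal
    (Filter.Eventually.of_forall fun _ => ENNReal.ofReal_lt_top)] at hg
  refine ⟨hg.congr hae.symm, ?_⟩
  rw [integral_withDensity_eq_integral_toReal_smul hp.ennreal_ofReal
    (Filter.Eventually.of_forall fun _ => ENNReal.ofReal_lt_top)]
  exact integral_congr_ae hae

theorem ae_posDefVolume {P : (UpperIdx m → ℝ) → Prop} (h : ∀ x ∈ posDefCoords m, P x) :
    ∀ᵐ x ∂posDefVolume m, P x :=
  (ae_restrict_iff' measurableSet_posDefCoords).mpr (Filter.Eventually.of_forall h)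

theorem isSymm_mul_mul {P V : Matrix (Fin m) (Fin m) ℝ} (hP : P.IsSymm) (hV : V.IsSymm) :
    (P * V * P).IsSymm := by
  rw [Matrix.IsSymm, transpose_mul, transpose_mul, hP.eq, hV.eq, Matrix.mul_assoc]

theorem nu_mem_posDefCoords {S : Matrix (Fin m) (Fin m) ℝ} (hS : S.PosDef) :
    nu S ∈ posDefCoords m := by
  rw [posDefCoords, Set.mem_ofPred_eq, symMat_nu (isSymm_of_posDef hS)]
  exact hS

variable {S : Matrix (Fin m) (Fin m) ℝ}

theorem wishart_fisher (hmn : m ≤ n) (hS : S.PosDef) (i j : UpperIdx m) :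
    Integrable (fisherIntegrand (wishartModel m n) (nu S) i j) (posDefVolume m) ∧
    ∫ x, fisherIntegrand (wishartModel m n) (nu S) i j x ∂posDefVolume m =
      n / 2 * (S⁻¹ * symMat (Pi.single i 1) * S⁻¹ * symMat (Pi.single j 1)).trace := by
  have hSi := isSymm_of_posDef hS.inv
  have hu := (isUnit_iff_isUnit_det _).mp hS.isUnit
  obtain ⟨h1, h2⟩ := integral_centredTrace_mul hmn hS
    (isSymm_mul_mul hSi (symMat_isSymm (Pi.single i 1)))
    (isSymm_mul_mul hSi (symMat_isSymm (Pi.single j 1)))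
  have hF : ∀ x ∈ posDefCoords m, 0 ≤ wishartModel m n (nu S) x ∧
      fisherIntegrand (wishartModel m n) (nu S) i j x = wishartModel m n (nu S) x *
        (centredTrace n S (S⁻¹ * symMat (Pi.single i 1) * S⁻¹) x *
          centredTrace n S (S⁻¹ * symMat (Pi.single j 1) * S⁻¹) x) := by
    intro x hx
    refine ⟨?_, ?_⟩
    · rw [wishartModel_nu hS]
      exact (wishartPDF_pos hmn hS hx).le
    · have hs : ∀ k, score (wishartModel m n) (nu S) k x =
          centredTrace n S (S⁻¹ * symMat (Pi.single k 1) * S⁻¹) x := by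
        intro k
        have := (hasDerivAt_log_wishartModel hmn (nu_mem_posDefCoords hS) hx (Pi.single k 1)).deriv
        rw [symMat_nu (isSymm_of_posDef hS)] at this
        exact this
      rw [fisherIntegrand, hs, hs, mul_assoc]
  obtain ⟨h3, h4⟩ := integrable_mul_and_integral_withDensity (measurable_wishartModel n (nu S))
    (ae_posDefVolume hF) h1
  refine ⟨h3, h4.trans (h2.trans ?_)⟩
  simp only [Matrix.mul_assoc, nonsing_inv_mul _ hu, Matrix.mul_one]

/-- The scores depend on X only through X⁻¹, so the integral is transported to the Wishart law with
parameter S⁻¹. The two sign changes cancel in the product. -/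
theorem invWishart_fisher (hmn : m ≤ n) (hS : S.PosDef) (i j : UpperIdx m) :
    Integrable (fisherIntegrand (invWishartModel m n) (nu S) i j) (posDefVolume m) ∧
    ∫ x, fisherIntegrand (invWishartModel m n) (nu S) i j x ∂posDefVolume m =
      n / 2 * (S⁻¹ * symMat (Pi.single i 1) * S⁻¹ * symMat (Pi.single j 1)).trace := by
  obtain ⟨h1, h2⟩ := integral_centredTrace_mul hmn hS.inv
    (symMat_isSymm (Pi.single i 1)) (symMat_isSymm (Pi.single j 1))
  rw [← map_invCoords_invWishartMeasure n hS] at h1 h2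
  have hae := measurable_invCoords.aemeasurable (μ := invWishartMeasure n S)
  rw [integral_map hae h1.aestronglyMeasurable] at h2
  replace h1 := h1.comp_aemeasurable hae
  have hF : ∀ x ∈ posDefCoords m, 0 ≤ invWishartModel m n (nu S) x ∧
      fisherIntegrand (invWishartModel m n) (nu S) i j x = invWishartModel m n (nu S) x *
        (centredTrace n S⁻¹ (symMat (Pi.single i 1)) (invCoords x) *
          centredTrace n S⁻¹ (symMat (Pi.single j 1)) (invCoords x)) := by
    intro x hx
    refine ⟨?_, ?_⟩
    · rw [invWishartModel_nu hS]
      exact (invWishartPDF_pos hmn hS hx).le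
    · have hs : ∀ k, score (invWishartModel m n) (nu S) k x =
          -centredTrace n S⁻¹ (symMat (Pi.single k 1)) (invCoords x) := by
        intro k
        have := (hasDerivAt_log_invWishartModel hmn (nu_mem_posDefCoords hS) hx
          (Pi.single k 1)).deriv
        rw [symMat_nu (isSymm_of_posDef hS)] at this
        exact this
      rw [fisherIntegrand, hs, hs]
      ring
  obtain ⟨h3, h4⟩ := integrable_mul_and_integral_withDensity (measurable_invWishartModel n (nu S))
    (ae_posDefVolume hF) h1
  refine ⟨h3, h4.trans (h2.trans ?_)⟩
  rw [trace_mul_comm]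
  simp only [Matrix.mul_assoc]

theorem smul_duplicationMatrix_apply (hS : S.PosDef) (i j : UpperIdx m) :
    (((n : ℝ) / 2) • ((duplicationMatrix m)ᵀ * (S⁻¹ ⊗ₖ S⁻¹) * duplicationMatrix m)) i j =
      n / 2 * (S⁻¹ * symMat (Pi.single i 1) * S⁻¹ * symMat (Pi.single j 1)).trace := by
  rw [← dotProduct_duplicationMatrix_mulVec _ (isSymm_of_posDef hS.inv), mulVec_single_one,
    single_one_dotProduct]
  rfl

theorem fisherMatrix_wishartModel (hmn : m ≤ n) (hS : S.PosDef) :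
    fisherMatrix (posDefVolume m) (wishartModel m n) (nu S) =
      ((n : ℝ) / 2) • ((duplicationMatrix m)ᵀ * (S⁻¹ ⊗ₖ S⁻¹) * duplicationMatrix m) := by
  ext i j
  rw [smul_duplicationMatrix_apply hS]
  exact (wishart_fisher hmn hS i j).2

theorem fisherMatrix_invWishartModel (hmn : m ≤ n) (hS : S.PosDef) :
    fisherMatrix (posDefVolume m) (invWishartModel m n) (nu S) =
      ((n : ℝ) / 2) • ((duplicationMatrix m)ᵀ * (S⁻¹ ⊗ₖ S⁻¹) * duplicationMatrix m) := by
  ext i j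
  rw [smul_duplicationMatrix_apply hS]
  exact (invWishart_fisher hmn hS i j).2

end

section

variable {m n : ℕ}

/-! ### The Fisher–Rao distance -/

/-- The norm of the velocity of the curve `c` for the affine-invariant metric. -/
def speed (c : ℝ → UpperIdx m → ℝ) (t : ℝ) : ℝ :=
  √(metricSq (symMat (c t)) (symMat (deriv c t)))

theorem dotProduct_fisherMatrix_mulVec (hmn : m ≤ n) {ξ : UpperIdx m → ℝ}
    (hξ : ξ ∈ posDefCoords m) (v : UpperIdx m → ℝ) :
    v ⬝ᵥ (fisherMatrix (posDefVolume m) (invWishartModel m n) ξ *ᵥ v) =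
      n / 2 * metricSq (symMat ξ) (symMat v) := by
  have h := fisherMatrix_invWishartModel (n := n) hmn hξ
  rw [nu_symMat] at h
  rw [h, smul_mulVec, dotProduct_smul, smul_eq_mul,
    dotProduct_duplicationMatrix_mulVec _ (isSymm_of_posDef (PosDef.inv hξ)), metricSq]

theorem curveLength_invWishartModel (hmn : m ≤ n) {c : ℝ → UpperIdx m → ℝ}
    (hc : ∀ t ∈ Set.Icc (0 : ℝ) 1, c t ∈ posDefCoords m) :
    curveLength (fisherMatrix (posDefVolume m) (invWishartModel m n)) c =
      √((n : ℝ) / 2) * ∫ t in (0 : ℝ)..1, speed c t := by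
  rw [curveLength, ← intervalIntegral.integral_const_mul]
  refine intervalIntegral.integral_congr fun t ht => ?_
  rw [Set.uIcc_of_le zero_le_one] at ht
  simp only [dotProduct_fisherMatrix_mulVec hmn (hc t ht), speed]
  rw [Real.sqrt_mul (by positivity)]

theorem continuousOn_metricSq {X V : ℝ → Matrix (Fin m) (Fin m) ℝ} {s : Set ℝ}
    (hX : ContinuousOn X s) (hV : ContinuousOn V s) (hp : ∀ t ∈ s, (X t).PosDef) :
    ContinuousOn (fun t => metricSq (X t) (V t)) s := by
  have hi : ContinuousOn (fun t => (X t)⁻¹) s := fun t ht =>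
    (continuousAt_matrix_inv (hp t ht).isUnit).comp_continuousWithinAt (hX t ht)
  exact (continuous_id.matrix_trace).comp_continuousOn (((hi.mul hV).mul hi).mul hV)

variable {c : ℝ → UpperIdx m → ℝ} {a b : ℝ}

/-- The derivative may be meaningless at the endpoints of a piece, but they form a null set. Inside,
it agrees with the one-sided `derivWithin`, which is continuous on the closed interval. -/
theorem integrableOn_speed (hc : ContDiffOn ℝ 1 c (Set.Icc a b)) (hab : a < b)
    (hp : ∀ t ∈ Set.Icc a b, c t ∈ posDefCoords m) : IntegrableOn (speed c) (Set.Icc a b) := by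
  have h1 : ContinuousOn (fun t => √(metricSq (symMat (c t))
      (symMat (derivWithin c (Set.Icc a b) t)))) (Set.Icc a b) :=
    Real.continuous_sqrt.comp_continuousOn (continuousOn_metricSq
      (continuous_symMat.comp_continuousOn hc.continuousOn)
      (continuous_symMat.comp_continuousOn
        (hc.continuousOn_derivWithin (uniqueDiffOn_Icc hab) le_rfl)) hp)
  rw [integrableOn_Icc_iff_integrableOn_Ioo]
  refine ((h1.integrableOn_Icc).mono_set Set.Ioo_subset_Icc_self).congr_fun ?_ measurableSet_Ioo
  intro t ht
  simp only [speed, derivWithin_of_mem_nhds (Icc_mem_nhds ht.1 ht.2)]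

/-- Integrates the gradient bound along one smooth piece. The congruence by L is an isometry, so the
speed is that of the original curve. -/
theorem logPivots_sub_le (hc : ContDiffOn ℝ 1 c (Set.Icc a b)) (hab : a < b)
    (hp : ∀ t ∈ Set.Icc a b, c t ∈ posDefCoords m) (l : Fin m → ℝ)
    {L : Matrix (Fin m) (Fin m) ℝ} (hL : IsUnit L) :
    logPivots l (symMat (congrCoords L (c b))) - logPivots l (symMat (congrCoords L (c a))) ≤
      ∫ t in a..b, √(∑ k, l k ^ 2) * speed c t := by
  have hd : ∀ t ∈ Set.Ioo a b, HasDerivAt (fun u => congrCoords L (c u))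
      (congrCoords L (deriv c t)) t := fun t ht =>
    (LinearMap.toContinuousLinearMap (congrCoords L)).hasFDerivAt.comp_hasDerivAt t
      ((hc.differentiableOn (by simp)).differentiableAt (Icc_mem_nhds ht.1 ht.2)).hasDerivAt
  have hpos : ∀ t ∈ Set.Icc a b, (symMat (congrCoords L (c t))).PosDef := fun t ht =>
    (mem_posDefCoords_congrCoords hL).mpr (hp t ht)
  have key : ∀ t ∈ Set.Ioo a b, ∃ δ,
      HasDerivAt (fun u => logPivots l (symMat (congrCoords L (c u)))) δ t ∧
        δ ≤ √(∑ k, l k ^ 2) * speed c t := by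
    intro t ht
    obtain ⟨δ, h1, h2⟩ := hasDerivAt_logPivots l (A := fun u => symMat (congrCoords L (c u)))
      (V := symMat (congrCoords L (deriv c t))) (t := t) (fun u => symMat_isSymm _)
      (hpos t (Set.Ioo_subset_Icc_self ht)) (symMat_isSymm _)
      (fun i j => (hasDerivAt_pi.mp (hd t ht)) (upperIdx i j))
    refine ⟨δ, h1, ?_⟩
    rw [speed, ← Real.sqrt_mul (Finset.sum_nonneg fun k _ => sq_nonneg _)]
    refine (le_abs_self δ).trans (Real.abs_le_sqrt ?_)
    simpa only [symMat_congrCoords, metricSq_congr hL] using h2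
  have hcont : ContinuousOn (fun u => logPivots l (symMat (congrCoords L (c u)))) (Set.Icc a b) := by
    refine continuousOn_logPivots l hpos fun i j => ?_
    have := (LinearMap.toContinuousLinearMap (congrCoords L)).continuous.comp_continuousOn
      hc.continuousOn
    exact (continuous_apply (upperIdx i j)).comp_continuousOn this
  choose! δ hδ using key
  exact intervalIntegral.sub_le_integral_of_hasDeriv_right_of_le hab.le hcont
    (fun t ht => (hδ t ht).1.hasDerivWithinAt) ((integrableOn_speed hc hab hp).const_mul _)
    fun t ht => (hδ t ht).2

theorem logPivots_sub_le_of_isPiecewiseC1 (hc : IsPiecewiseC1 c)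
    (hp : ∀ t ∈ Set.Icc (0 : ℝ) 1, c t ∈ posDefCoords m) (l : Fin m → ℝ)
    {L : Matrix (Fin m) (Fin m) ℝ} (hL : IsUnit L) :
    logPivots l (symMat (congrCoords L (c 1))) - logPivots l (symMat (congrCoords L (c 0))) ≤
      √(∑ k, l k ^ 2) * ∫ t in (0 : ℝ)..1, speed c t := by
  obtain ⟨-, N, t, ht0, htN, ht⟩ := hc
  have hmono : ∀ j ≤ N, ∀ i ≤ j, t i ≤ t j := by
    intro j hj
    induction j with
    | zero => intro i hi; rw [Nat.le_zero.mp hi]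
    | succ j ih =>
      intro i hi
      rcases Nat.le_succ_iff.mp hi with h | h
      · exact (ih (by omega) i h).trans (ht j (by omega)).1.le
      · rw [h]
  have hsub : ∀ k < N, ∀ s ∈ Set.Icc (t k) (t (k + 1)), c s ∈ posDefCoords m := by
    intro k hk s hs
    refine hp s ⟨?_, ?_⟩
    · rw [← ht0]; exact (hmono k hk.le 0 (Nat.zero_le _)).trans hs.1
    · rw [← htN]; exact hs.2.trans (hmono N le_rfl (k + 1) hk)
  have hsum := Finset.sum_le_sum fun k (hk : k ∈ Finset.range N) =>
    logPivots_sub_le (ht k (Finset.mem_range.mp hk)).2 (ht k (Finset.mem_range.mp hk)).1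
      (hsub k (Finset.mem_range.mp hk)) l hL
  rw [Finset.sum_range_sub (fun k => logPivots l (symMat (congrCoords L (c (t k))))),
    intervalIntegral.sum_integral_adjacent_intervals, ht0, htN,
    intervalIntegral.integral_const_mul] at hsum
  · exact hsum
  · intro k hk
    refine (intervalIntegrable_iff_integrableOn_Icc_of_le (ht k hk).1.le).mpr ?_
    exact (integrableOn_speed (ht k hk).2 (ht k hk).1 (hsub k hk)).const_mul _

theorem integral_speed_nonneg (c : ℝ → UpperIdx m → ℝ) : 0 ≤ ∫ t in (0 : ℝ)..1, speed c t :=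
  intervalIntegral.integral_nonneg zero_le_one fun _ _ => Real.sqrt_nonneg _

/-! ### The sharp lower bound and the minimizing curve. -/

variable {B : Matrix (Fin m) (Fin m) ℝ} {d : Fin m → ℝ}

/-- The congruence by B⁻¹ moves the endpoints to 1 and diag(d). With weights log dₖ, the increment
is Λ = ∑ log² dₖ and the Lipschitz constant is √Λ, so division by √Λ gives the bound. -/
theorem sqrt_sum_log_sq_le (hB : IsUnit B) (hc : IsPiecewiseC1 c)
    (hp : ∀ t ∈ Set.Icc (0 : ℝ) 1, c t ∈ posDefCoords m) (h0 : symMat (c 0) = B * Bᵀ)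
    (h1 : symMat (c 1) = B * diagonal d * Bᵀ) :
    √(∑ k, Real.log (d k) ^ 2) ≤ ∫ t in (0 : ℝ)..1, speed c t := by
  have hd := (isUnit_iff_isUnit_det B).mp hB
  have hBi : IsUnit B⁻¹ := isUnit_nonsing_inv_iff.mpr hB
  have e1 : B⁻¹ * B = 1 := nonsing_inv_mul _ hd
  have e2 : Bᵀ * B⁻¹ᵀ = 1 := by rw [← transpose_mul, e1, transpose_one]
  have h := logPivots_sub_le_of_isPiecewiseC1 hc hp (fun k => Real.log (d k)) hBi
  have hs0 : symMat (congrCoords B⁻¹ (c 0)) = diagonal fun _ => 1 := by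
    rw [symMat_congrCoords, h0, ← Matrix.mul_assoc, e1, Matrix.one_mul, e2, diagonal_one]
  have hs1 : symMat (congrCoords B⁻¹ (c 1)) = diagonal d := by
    rw [symMat_congrCoords, h1, Matrix.mul_assoc, Matrix.mul_assoc _ Bᵀ, e2, Matrix.mul_one,
      ← Matrix.mul_assoc, e1, Matrix.one_mul]
  rw [hs0, hs1, logPivots_diagonal, logPivots_diagonal] at h
  simp only [Real.log_one, mul_zero, Finset.sum_const_zero, sub_zero, ← pow_two] at h
  set Λ := ∑ k, Real.log (d k) ^ 2
  have hΛ : 0 ≤ Λ := Finset.sum_nonneg fun k _ => sq_nonneg _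
  -- When √Λ = 0 there is nothing to divide by, and nonnegativity of the length suffices.
  rcases (Real.sqrt_nonneg Λ).eq_or_lt with h2 | h2
  · rw [← h2]
    exact integral_speed_nonneg c
  · rw [← Real.mul_self_sqrt hΛ] at h
    rw [Real.sqrt_mul_self (Real.sqrt_nonneg Λ)] at h
    exact le_of_mul_le_mul_left h h2

/-- The curve `t ↦ B diag(d₁ᵗ, …, dₘᵗ) Bᵀ`. -/
def geodesic (B : Matrix (Fin m) (Fin m) ℝ) (d : Fin m → ℝ) (t : ℝ) : UpperIdx m → ℝ :=
  congrCoords B (nu (diagonal fun k => Real.exp (t * Real.log (d k))))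

theorem symMat_geodesic (B : Matrix (Fin m) (Fin m) ℝ) (d : Fin m → ℝ) (t : ℝ) :
    symMat (geodesic B d t) = B * diagonal (fun k => Real.exp (t * Real.log (d k))) * Bᵀ := by
  rw [geodesic, symMat_congrCoords, symMat_nu (isSymm_diagonal _)]

theorem geodesic_mem (hB : IsUnit B) (d : Fin m → ℝ) (t : ℝ) :
    geodesic B d t ∈ posDefCoords m := by
  rw [geodesic, mem_posDefCoords_congrCoords hB]
  exact nu_mem_posDefCoords (posDef_diagonal_iff.mpr fun k => Real.exp_pos _)

theorem contDiff_geodesic (B : Matrix (Fin m) (Fin m) ℝ) (d : Fin m → ℝ) :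
    ContDiff ℝ 1 (geodesic B d) := by
  refine (LinearMap.toContinuousLinearMap (congrCoords B)).contDiff.comp ?_
  refine contDiff_pi.mpr fun q => ?_
  simp only [nu, diagonal_apply]
  split_ifs
  · fun_prop
  · exact contDiff_const

theorem hasDerivAt_geodesic (B : Matrix (Fin m) (Fin m) ℝ) (d : Fin m → ℝ) (t : ℝ) :
    HasDerivAt (geodesic B d) (congrCoords B
      (nu (diagonal fun k => Real.exp (t * Real.log (d k)) * Real.log (d k)))) t := by
  refine (LinearMap.toContinuousLinearMap (congrCoords B)).hasFDerivAt.comp_hasDerivAt t ?_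
  refine hasDerivAt_pi.mpr fun q => ?_
  simp only [nu, diagonal_apply]
  split_ifs
  · simpa using (((hasDerivAt_id t).mul_const (Real.log (d q.1.1))).exp)
  · exact hasDerivAt_const _ _

theorem speed_geodesic (hB : IsUnit B) (d : Fin m → ℝ) (t : ℝ) :
    speed (geodesic B d) t = √(∑ k, Real.log (d k) ^ 2) := by
  rw [speed, (hasDerivAt_geodesic B d t).deriv, symMat_geodesic, symMat_congrCoords,
    symMat_nu (isSymm_diagonal _), metricSq_congr hB]
  have hinv : (diagonal fun k => Real.exp (t * Real.log (d k)))⁻¹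
      = diagonal fun k => Real.exp (-(t * Real.log (d k))) := by
    apply inv_eq_right_inv
    rw [diagonal_mul_diagonal, ← diagonal_one]
    congr 1
    ext k
    rw [← Real.exp_add, add_neg_cancel, Real.exp_zero]
  rw [metricSq, hinv, diagonal_mul_diagonal, diagonal_mul_diagonal, diagonal_mul_diagonal,
    trace_diagonal]
  congr 1
  refine Finset.sum_congr rfl fun k _ => ?_
  have : Real.exp (-(t * Real.log (d k))) * Real.exp (t * Real.log (d k)) = 1 := by
    rw [← Real.exp_add, neg_add_cancel, Real.exp_zero]
  -- With p the product of the two exponentials, this is p² - 1 = (p + 1)(p - 1).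
  linear_combination (Real.exp (-(t * Real.log (d k))) * Real.exp (t * Real.log (d k)) + 1)
    * Real.log (d k) ^ 2 * this

theorem isPiecewiseC1_of_contDiff {ι : Type*} [Fintype ι] {c : ℝ → ι → ℝ} (hc : ContDiff ℝ 1 c) :
    IsPiecewiseC1 c :=
  ⟨hc.continuous.continuousOn, 1, fun k => k, by simp, by simp, fun k _ =>
    ⟨by simp, hc.contDiffOn⟩⟩

/-- The infimum is attained by `geodesic`, so the value is a least element and the set of lengths
needs no separate discussion. -/
theorem fisherRaoDist_invWishartModel (hmn : m ≤ n) (hB : IsUnit B) (hd : ∀ k, 0 < d k)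
    {ξ₁ ξ₂ : UpperIdx m → ℝ} (h₁ : symMat ξ₁ = B * Bᵀ) (h₂ : symMat ξ₂ = B * diagonal d * Bᵀ) :
    fisherRaoDist (posDefCoords m) (posDefVolume m) (invWishartModel m n) ξ₁ ξ₂ =
      √((n : ℝ) / 2) * √(∑ k, Real.log (d k) ^ 2) := by
  refine IsLeast.csInf_eq ⟨?_, ?_⟩
  · refine ⟨geodesic B d, isPiecewiseC1_of_contDiff (contDiff_geodesic B d),
      fun t _ => geodesic_mem hB d t, ?_, ?_, ?_⟩
    · rw [← nu_symMat (geodesic B d 0), symMat_geodesic, ← nu_symMat ξ₁, h₁]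
      simp
    · rw [← nu_symMat (geodesic B d 1), symMat_geodesic, ← nu_symMat ξ₂, h₂]
      simp only [one_mul, Real.exp_log (hd _)]
    · rw [curveLength_invWishartModel hmn fun t _ => geodesic_mem hB d t]
      simp [speed_geodesic hB]
  · rintro _ ⟨c, hc, hp, hc0, hc1, rfl⟩
    rw [curveLength_invWishartModel hmn hp]
    refine mul_le_mul_of_nonneg_left ?_ (Real.sqrt_nonneg _)
    exact sqrt_sum_log_sq_le hB hc hp (by rw [hc0, h₁]) (by rw [hc1, h₂])

theorem frobNorm_orthogonal_conj {U : Matrix (Fin m) (Fin m) ℝ} (hU : Uᵀ * U = 1)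
    (l : Fin m → ℝ) : frobNorm (U * diagonal l * Uᵀ) = √(∑ k, l k ^ 2) := by
  rw [frobNorm, transpose_mul, transpose_mul, transpose_transpose, diagonal_transpose]
  congr 1
  calc (U * diagonal l * Uᵀ * (U * (diagonal l * Uᵀ))).trace
      = (U * (diagonal l * ((Uᵀ * U) * (diagonal l * Uᵀ)))).trace := by
        simp only [Matrix.mul_assoc]
    _ = (diagonal l * diagonal l * (Uᵀ * U)).trace := by
        rw [hU, Matrix.one_mul, trace_mul_comm]
        simp only [Matrix.mul_assoc, hU]
    _ = ∑ k, l k ^ 2 := by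
        rw [hU, Matrix.mul_one, diagonal_mul_diagonal, trace_diagonal]
        simp only [pow_two]

theorem invWishartDist_eq (hmn : m ≤ n) {S₁ S₂ : Matrix (Fin m) (Fin m) ℝ} (hS₁ : S₁.PosDef)
    (hS₂ : S₂.PosDef) : invWishartDist n S₁ S₂ =
        √((n : ℝ) / 2) * frobNorm (matLog (invSqrt S₁ * S₂ * invSqrt S₁)) ∧
      ∃ h : (invSqrt S₁ * S₂ * invSqrt S₁).IsHermitian,
        invWishartDist n S₁ S₂ = √((n : ℝ) / 2 * ∑ k, Real.log (h.eigenvalues k) ^ 2) := by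
  have hRp := posDef_invSqrt hS₁
  have hRs : (invSqrt S₁)ᵀ = invSqrt S₁ := isSymm_of_posDef hRp
  have hRd := (isUnit_iff_isUnit_det _).mp hRp.isUnit
  have hM : (invSqrt S₁ * S₂ * invSqrt S₁).PosDef := by
    have := (Matrix.IsUnit.posDef_star_right_conjugate_iff hRp.isUnit).mpr hS₂
    rwa [star_eq_conjTranspose, conjTranspose_eq_transpose_of_trivial, hRs] at this
  obtain ⟨U, hU1, hU2, hU3, hU4⟩ := cfc_eq_mul_diagonal_mul hM.1
  have hRi : (invSqrt S₁)⁻¹ᵀ = (invSqrt S₁)⁻¹ := by rw [transpose_nonsing_inv, hRs]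
  -- B = S₁^(1/2) U, with U diagonalizing S₁^(-1/2) S₂ S₁^(-1/2), gives S₁ = BBᵀ and S₂ = B diag(λ)
  -- Bᵀ.
  have hB : IsUnit ((invSqrt S₁)⁻¹ * U) := (isUnit_nonsing_inv_iff.mpr hRp.isUnit).mul
    ((isUnit_iff_isUnit_det U).mpr (isUnit_det_of_right_inverse hU1))
  have hdist : invWishartDist n S₁ S₂ =
      √((n : ℝ) / 2) * √(∑ k, Real.log (hM.1.eigenvalues k) ^ 2) := by
    refine fisherRaoDist_invWishartModel hmn hB hM.eigenvalues_pos ?_ ?_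
    · rw [symMat_nu (isSymm_of_posDef hS₁), transpose_mul, hRi, Matrix.mul_assoc,
        ← Matrix.mul_assoc U, hU1, Matrix.one_mul, inv_invSqrt_mul_self hS₁]
    · rw [symMat_nu (isSymm_of_posDef hS₂), transpose_mul, hRi]
      calc S₂ = (invSqrt S₁)⁻¹ * (invSqrt S₁ * S₂ * invSqrt S₁) * (invSqrt S₁)⁻¹ := by
            rw [Matrix.mul_assoc (invSqrt S₁), ← Matrix.mul_assoc, nonsing_inv_mul _ hRd,
              Matrix.one_mul, Matrix.mul_assoc, mul_nonsing_inv _ hRd, Matrix.mul_one]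
        _ = (invSqrt S₁)⁻¹ * (U * diagonal hM.1.eigenvalues * Uᵀ) * (invSqrt S₁)⁻¹ :=
            congrArg (fun X => (invSqrt S₁)⁻¹ * X * (invSqrt S₁)⁻¹) hU3
        _ = _ := by simp only [Matrix.mul_assoc]
  refine ⟨?_, hM.1, ?_⟩
  · rw [hdist, matLog, hU4, frobNorm_orthogonal_conj hU2]
  · rw [hdist, Real.sqrt_mul (by positivity)]

end

end FisherRao

end

theorem mainTheorem6 (m n : ℕ) (hmn : m ≤ n) :
    -- the laws, and the relation `Y = X⁻¹`, `Φ = S⁻¹`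
    (∀ S : Matrix (Fin m) (Fin m) ℝ, S.PosDef →
      IsProbabilityMeasure (invWishartMeasure n S) ∧
      (invWishartMeasure n S).map invCoords = wishartMeasure n S⁻¹) ∧
    -- the Fisher matrix
    (∀ S : Matrix (Fin m) (Fin m) ℝ, S.PosDef →
      (∀ i j, Integrable (fisherIntegrand (invWishartModel m n) (nu S) i j) (posDefVolume m)) ∧
      (∀ i j, Integrable (fisherIntegrand (wishartModel m n) (nu S) i j) (posDefVolume m)) ∧
      fisherMatrix (posDefVolume m) (invWishartModel m n) (nu S) =
        ((n : ℝ) / 2) • ((duplicationMatrix m)ᵀ * (S⁻¹ ⊗ₖ S⁻¹) * duplicationMatrix m) ∧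
      fisherMatrix (posDefVolume m) (wishartModel m n) (nu S) =
        ((n : ℝ) / 2) • ((duplicationMatrix m)ᵀ * (S⁻¹ ⊗ₖ S⁻¹) * duplicationMatrix m)) ∧
    -- the Fisher–Rao distance
    (∀ S₁ S₂ : Matrix (Fin m) (Fin m) ℝ, S₁.PosDef → S₂.PosDef →
      invWishartDist n S₁ S₂ =
        √((n : ℝ) / 2) * frobNorm (matLog (invSqrt S₁ * S₂ * invSqrt S₁)) ∧
      ∃ h : (invSqrt S₁ * S₂ * invSqrt S₁).IsHermitian,
        invWishartDist n S₁ S₂ =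
          √((n : ℝ) / 2 * ∑ k, Real.log (h.eigenvalues k) ^ 2)) := by
  refine ⟨fun S hS => ⟨isProbabilityMeasure_invWishartMeasure hmn hS,
    map_invCoords_invWishartMeasure n hS⟩, fun S hS => ⟨fun i j => (invWishart_fisher hmn hS i j).1,
    fun i j => (wishart_fisher hmn hS i j).1, fisherMatrix_invWishartModel hmn hS,
    fisherMatrix_wishartModel hmn hS⟩, fun S₁ S₂ hS₁ hS₂ => invWishartDist_eq hmn hS₁ hS₂⟩
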